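/- Let $k$ and $n$ be integers such that either $k\ge 3$ is odd and $n\ge 2k+4$, or $k=2$ and $n\ge 9$. Then there exists a neighborly $(2k+1)$-polytope $P\subset\mathbb{R}^{2k+1}$ with exactly $n$ vertices all of whose missing faces have dimension $k$ (that is, have exactly $k+1$ elements); in particular, $m_{k+1}(P)=0$. Here a $d$-polytope is the convex hull of a finite set of points whose affine span has dimension $d$; it is simplicial if all of its proper faces are simplices. The boundary complex $\partial P$ of a simplicial polytope $P$ is the collection of vertex sets of proper faces of $P$ (including $\emptyset$). A $d$-polytope is neighborly if it is simplicial and every set of $\lfloor d/2\rfloor$ of its vertices belongs to $\partial P$, equivalently $f_{\lfloor d/2\rfloor-1}=\binom{f_0}{\lfloor d/2\rfloor}$, where $f_{j-1}$ is the number of $j$-element sets in $\partial P$. A missing face of $P$ is a set $M$ of vertices of $P$ such that $M\notin\partial P$ but every proper subset of $M$ belongs to $\partial P$; its dimension is $|M|-1$, and $m_i(P)$ is the number of missing faces of dimension $i$. -/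

import Mathlib

namespace ConvexPolytope

/-- A polytope: the convex hull of a finite set of points. -/
def IsPolytope {E : Type*} [NormedAddCommGroup E] [NormedSpace ℝ E] (P : Set E) : Prop :=
  ∃ S : Finset E, P = convexHull ℝ (S : Set E)

/-- The dimension of `P`: the dimension of its affine span. -/
noncomputable def dim {E : Type*} [NormedAddCommGroup E] [NormedSpace ℝ E] (P : Set E) : ℕ :=
  Module.finrank ℝ (vectorSpan ℝ P)

/-- The vertices of `P`. -/
def vertices {E : Type*} [NormedAddCommGroup E] [NormedSpace ℝ E] (P : Set E) : Set E :=
  P.extremePoints ℝ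

/-- A proper face of `P`: the intersection of `P` with a supporting hyperplane (equivalently, the
set of maximizers on `P` of a linear functional), other than `P` itself. As usual, the empty set
is counted as a (proper) face. -/
def IsProperFace {E : Type*} [NormedAddCommGroup E] [NormedSpace ℝ E] (P F : Set E) : Prop :=
  IsExposed ℝ P F ∧ F ≠ P

/-- A simplex: the convex hull of finitely many affinely independent points. -/
def IsSimplex {E : Type*} [NormedAddCommGroup E] [NormedSpace ℝ E] (F : Set E) : Prop :=
  ∃ S : Finset E, AffineIndependent ℝ ((↑) : S → E) ∧ F = convexHull ℝ (S : Set E)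

/-- `P` is simplicial: all of its proper faces are simplices. -/
def IsSimplicial {E : Type*} [NormedAddCommGroup E] [NormedSpace ℝ E] (P : Set E) : Prop :=
  ∀ F : Set E, IsProperFace P F → IsSimplex F

/-- The boundary complex of `P`: the collection of the vertex sets of the proper faces of `P`
(the empty set included). -/
def boundaryComplex {E : Type*} [NormedAddCommGroup E] [NormedSpace ℝ E] (P : Set E) :
    Set (Finset E) :=
  {s | ∃ F : Set E, IsProperFace P F ∧ (s : Set E) = vertices F}

/-- The number of faces with exactly `j` elements in the boundary complex of `P`; in terms of the
`f`-vector, this is `f_{j-1}(P)`. -/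
noncomputable def faceCount {E : Type*} [NormedAddCommGroup E] [NormedSpace ℝ E] (P : Set E)
    (j : ℕ) : ℕ :=
  {s : Finset E | s ∈ boundaryComplex P ∧ s.card = j}.ncard

/-- `P` is `i`-neighborly: `f_{i-1} = (f_0 choose i)`. -/
def IsNeighborlyOfOrder {E : Type*} [NormedAddCommGroup E] [NormedSpace ℝ E] (i : ℕ)
    (P : Set E) : Prop :=
  faceCount P i = (faceCount P 1).choose i

/-- `P` is neighborly: a simplicial polytope that is `⌊d/2⌋`-neighborly, where `d = dim P`. -/
def IsNeighborly {E : Type*} [NormedAddCommGroup E] [NormedSpace ℝ E] (P : Set E) : Prop :=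
  IsPolytope P ∧ IsSimplicial P ∧ IsNeighborlyOfOrder (dim P / 2) P

/-- `M` is a missing face of `P`: a set of vertices of `P` that is not a face of the boundary
complex although all of its proper subsets are. -/
def IsMissingFace {E : Type*} [NormedAddCommGroup E] [NormedSpace ℝ E] (P : Set E)
    (M : Finset E) : Prop :=
  (M : Set E) ⊆ vertices P ∧ M ∉ boundaryComplex P ∧ ∀ s : Finset E, s ⊂ M → s ∈ boundaryComplex P

/-- The number `m_i(P)` of missing `i`-faces of `P`, that is, missing faces with `i + 1`
elements. -/
noncomputable def missingFaceCount {E : Type*} [NormedAddCommGroup E] [NormedSpace ℝ E]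
    (P : Set E) (i : ℕ) : ℕ :=
  {M : Finset E | IsMissingFace P M ∧ M.card = i + 1}.ncard

end ConvexPolytope

/-! The polytope is treated homogeneously: its vertices become functionals `v i` on a space of
dimension d + 1 in general position, and a set is a face when some nonzero h is nonnegative on all
`v i` and vanishes on the set. With d = 2k + 1 two properties are wanted: all sets of at most k
indices are faces, and every nonface contains a nonface with at most k + 1 elements. Together they
force each minimal nonface to have exactly k + 1 elements, and `exists_polytope` turns such a
configuration into the polytope.

Vertices are added one at a time by sewing. Along a flag of pairs (a, b), (c, d), ..., the new
vector is v a - s • v b + s² • l, where l is built in the same way from the rest of the flag and the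
last stage is a generic interior vector. For small s its sign at a fixed h is that of the first
nonzero number among v a h, -v b h, v c h, -v d h, .... Compactness in one direction and explicit
perturbation in the other describe the new faces (`exists_lexStep`): away from the edge ab the new
vector behaves like a copy of a, and over sets containing a and b the rest of the flag decides.

If the faces of the flag have links that are neighborly, with order dropping by one at each pair,
and if the minimal nonfaces of these links are small, then the extended configuration has both
wanted properties and the same flag is again good (`GoodFlag.extend`). Hence one good configuration
yields all larger numbers of vertices. Bounding the nonfaces of every link is too much to ask of the
odd starting configuration. `GoodFlag.double` therefore skips the bound at an intermediate face and
keeps it only for nonfaces through the next vertex c.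

The starting configurations are Gale duals. For odd k there are 2k + 4 vectors, dual to alternating
vectors in the plane, and a nonface is recognized by a single sign change. For k = 2, nine explicit
vectors in dimension three are checked by finite certificates. -/

open Filter Topology

/-! ### Faces of vector configurations in general position -/

namespace VectorConfig

/-- `S` is (contained in) a face of the cone spanned by the configuration `v`: some nonzero
functional is nonnegative on `v` and vanishes on `S`. -/
def IsFace {W ι : Type*} [AddCommGroup W] [Module ℝ W] (v : ι → W →ₗ[ℝ] ℝ) (S : Finset ι) : Prop :=
  ∃ h : W, h ≠ 0 ∧ (∀ i, 0 ≤ v i h) ∧ ∀ i ∈ S, v i h = 0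

/-- General position: a nonzero functional vanishes on at most `d` of the more than `d` vectors,
which live in a space of dimension `d + 1`. -/
structure GenPos {W ι : Type*} [AddCommGroup W] [Module ℝ W] [Fintype ι]
    (v : ι → W →ₗ[ℝ] ℝ) (d : ℕ) : Prop where
  finrank_eq : Module.finrank ℝ W = d + 1
  lt_card : d < Fintype.card ι
  eq_zero : ∀ (h : W) (S : Finset ι), (∀ i ∈ S, v i h = 0) → d < S.card → h = 0

/-- The configuration `v` with the additional vector `y`. -/
def extend {W ι : Type*} [AddCommGroup W] [Module ℝ W] (v : ι → W →ₗ[ℝ] ℝ) (y : W →ₗ[ℝ] ℝ) :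
    Option ι → W →ₗ[ℝ] ℝ := fun o => o.elim y v

/-- `S` is a face of the configuration extended by `y`. -/
def FaceWithout {W ι : Type*} [AddCommGroup W] [Module ℝ W] (v : ι → W →ₗ[ℝ] ℝ) (y : W →ₗ[ℝ] ℝ)
    (S : Finset ι) : Prop :=
  ∃ h : W, h ≠ 0 ∧ (∀ i, 0 ≤ v i h) ∧ 0 ≤ y h ∧ ∀ i ∈ S, v i h = 0

/-- `S` together with the new vector is a face of the configuration extended by `y`. -/
def FaceWith {W ι : Type*} [AddCommGroup W] [Module ℝ W] (v : ι → W →ₗ[ℝ] ℝ) (y : W →ₗ[ℝ] ℝ)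
    (S : Finset ι) : Prop :=
  ∃ h : W, h ≠ 0 ∧ (∀ i, 0 ≤ v i h) ∧ y h = 0 ∧ ∀ i ∈ S, v i h = 0

section Basic

variable {W ι : Type*} [AddCommGroup W] [Module ℝ W] {v : ι → W →ₗ[ℝ] ℝ} {y : W →ₗ[ℝ] ℝ}
  {S T : Finset ι}

theorem IsFace.mono (h : IsFace v T) (hST : S ⊆ T) : IsFace v S := by
  obtain ⟨f, h0, h1, h2⟩ := h
  exact ⟨f, h0, h1, fun i hi => h2 i (hST hi)⟩

theorem FaceWithout.mono (h : FaceWithout v y T) (hST : S ⊆ T) : FaceWithout v y S := by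
  obtain ⟨f, h0, h1, h2, h3⟩ := h
  exact ⟨f, h0, h1, h2, fun i hi => h3 i (hST hi)⟩

theorem FaceWith.mono (h : FaceWith v y T) (hST : S ⊆ T) : FaceWith v y S := by
  obtain ⟨f, h0, h1, h2, h3⟩ := h
  exact ⟨f, h0, h1, h2, fun i hi => h3 i (hST hi)⟩

theorem FaceWithout.isFace (h : FaceWithout v y S) : IsFace v S := by
  obtain ⟨f, h0, h1, h2, h3⟩ := h
  exact ⟨f, h0, h1, h3⟩

theorem isFace_extend_of_notMem {T : Finset (Option ι)} (hT : none ∉ T) :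
    IsFace (extend v y) T ↔ FaceWithout v y (Finset.eraseNone T) := by
  constructor
  · rintro ⟨f, h0, h1, h2⟩
    exact ⟨f, h0, fun i => h1 (some i), h1 none, fun i hi => h2 (some i) (by simpa using hi)⟩
  · rintro ⟨f, h0, h1, h2, h3⟩
    refine ⟨f, h0, ?_, ?_⟩
    · rintro (_ | i)
      · exact h2
      · exact h1 i
    · rintro (_ | i) hi
      · exact absurd hi hT
      · exact h3 i (by simpa using hi)

theorem isFace_extend_of_mem {T : Finset (Option ι)} (hT : none ∈ T) :
    IsFace (extend v y) T ↔ FaceWith v y (Finset.eraseNone T) := by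
  constructor
  · rintro ⟨f, h0, h1, h2⟩
    exact ⟨f, h0, fun i => h1 (some i), h2 none hT, fun i hi => h2 (some i) (by simpa using hi)⟩
  · rintro ⟨f, h0, h1, h2, h3⟩
    refine ⟨f, h0, ?_, ?_⟩
    · rintro (_ | i)
      · exact h2.ge
      · exact h1 i
    · rintro (_ | i) hi
      · exact h2
      · exact h3 i (by simpa using hi)

variable [Fintype ι] {d : ℕ}

/-- Any d + 1 of the functionals form a basis of the dual space, so their values can be prescribed
freely. -/
theorem GenPos.exists_eval_eq [FiniteDimensional ℝ W] (hv : GenPos v d) (hS : S.card ≤ d + 1)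
    (f : ι → ℝ) : ∃ g : W, ∀ i ∈ S, v i g = f i := by
  classical
  obtain ⟨T, hST, hT⟩ := Finset.exists_superset_card_eq hS hv.lt_card
  let e : W →ₗ[ℝ] (T → ℝ) := LinearMap.pi fun i => v i
  have hinj : Function.Injective e := by
    rw [← LinearMap.ker_eq_bot, LinearMap.ker_eq_bot']
    intro h hh
    refine hv.eq_zero h T (fun i hi => ?_) (by omega)
    exact congrFun hh ⟨i, hi⟩
  have hsurj : Function.Surjective e := by
    refine (LinearMap.injective_iff_surjective_of_finrank_eq_finrank ?_).1 hinj
    simp [hv.finrank_eq, hT]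
  obtain ⟨g, hg⟩ := hsurj fun i => f i
  exact ⟨g, fun i hi => congrFun hg ⟨i, hST hi⟩⟩

theorem GenPos.card_le (hv : GenPos v d) {h : W} (h0 : h ≠ 0) (hS : ∀ i ∈ S, v i h = 0) :
    S.card ≤ d := by
  by_contra hc
  exact h0 (hv.eq_zero h S hS (by omega))

theorem GenPos.exists_pos (hv : GenPos v d) {h : W} (h0 : h ≠ 0) (hn : ∀ i, 0 ≤ v i h) :
    ∃ i, 0 < v i h := by
  by_contra! hc
  refine h0 (hv.eq_zero h Finset.univ (fun i _ => le_antisymm (hc i) (hn i)) ?_)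
  simpa using hv.lt_card

theorem eventually_pos_add_mul {c : ℝ} (hc : 0 < c) (e : ℝ) :
    ∀ᶠ t in 𝓝[>] (0 : ℝ), 0 < c + t * e := by
  have : Tendsto (fun t : ℝ => c + t * e) (𝓝[>] 0) (𝓝 (c + 0 * e)) := by
    apply Tendsto.mono_left _ nhdsWithin_le_nhds
    exact (Continuous.tendsto (by fun_prop) 0)
  refine this.eventually (lt_mem_nhds ?_)
  simpa using hc

/-- A witness has at most d zeros, so general position provides a g equal to 0 on S and to 1 at the
superfluous zeros; adding a small positive multiple of g removes those zeros. Thus every subset of a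
face is itself the exact zero set of a witness. -/
theorem IsFace.exists_strict [FiniteDimensional ℝ W] (hv : GenPos v d) (hS : IsFace v S) :
    ∃ h : W, (∀ i ∈ S, v i h = 0) ∧ ∀ i ∉ S, 0 < v i h := by
  classical
  obtain ⟨h, h0, h1, h2⟩ := hS
  let Z : Finset ι := Finset.univ.filter fun i => v i h = 0
  have hZ : Z.card ≤ d := hv.card_le h0 fun i hi => (Finset.mem_filter.1 hi).2
  obtain ⟨g, hg⟩ := hv.exists_eval_eq (S := Z) (by omega) fun i => if i ∈ S then 0 else 1
  have key : ∀ i, ∀ᶠ t in 𝓝[>] (0 : ℝ), i ∉ S → 0 < v i h + t * v i g := by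
    intro i
    rcases (h1 i).lt_or_eq with hi | hi
    · filter_upwards [eventually_pos_add_mul hi (v i g)] with t ht _ using ht
    · filter_upwards [self_mem_nhdsWithin] with t ht hiS
      rw [hg i (by simp [Z, hi.symm]), ← hi]
      simpa [hiS] using ht
  obtain ⟨t, ht⟩ := (eventually_all.2 key).exists
  refine ⟨h + t • g, fun i hi => ?_, fun i hi => ?_⟩
  · rw [map_add, map_smul, h2 i hi, hg i (by simp [Z, h2 i hi])]
    simp [hi]
  · simpa using ht i hi

theorem FaceWithout.exists_strict [FiniteDimensional ℝ W] (hv : GenPos (extend v y) d)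
    (hS : FaceWithout v y S) :
    ∃ h : W, (∀ i ∈ S, v i h = 0) ∧ (∀ i ∉ S, 0 < v i h) ∧ 0 < y h := by
  classical
  have hS' : IsFace (extend v y) (S.map Function.Embedding.some) := by
    rw [isFace_extend_of_notMem (by simp)]
    simpa using hS
  obtain ⟨h, h1, h2⟩ := hS'.exists_strict hv
  exact ⟨h, fun i hi => h1 (some i) (by simpa using hi), fun i hi => h2 (some i) (by simpa using hi),
    h2 none (by simp)⟩

end Basic

end VectorConfig

/-! ### Small lexicographic perturbations: limits and explicit witnesses -/

namespace VectorConfig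

/-- The vector `v a - s • v b + s ^ 2 • l`. -/
def lexVec {W ι : Type*} [AddCommGroup W] [Module ℝ W] (v : ι → W →ₗ[ℝ] ℝ) (a b : ι)
    (l : W →ₗ[ℝ] ℝ) (s : ℝ) : W →ₗ[ℝ] ℝ := v a - s • v b + s ^ 2 • l

section Lex

variable {W ι : Type*} [NormedAddCommGroup W] [NormedSpace ℝ W]
  {v : ι → W →ₗ[ℝ] ℝ} {a b : ι} {l y : W →ₗ[ℝ] ℝ} {S : Finset ι} {d : ℕ}

theorem lexVec_apply (s : ℝ) (h : W) :
    lexVec v a b l s h = v a h - s * v b h + s ^ 2 * l h := by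
  simp [lexVec]

theorem norm_normalize {h : W} (h0 : h ≠ 0) : ‖(‖h‖⁻¹ • h)‖ = 1 := by
  rw [norm_smul, norm_inv, norm_norm, inv_mul_cancel₀ (norm_ne_zero_iff.2 h0)]

theorem FaceWith.exists_norm (h : FaceWith v y S) :
    ∃ h : W, ‖h‖ = 1 ∧ (∀ i, 0 ≤ v i h) ∧ y h = 0 ∧ ∀ i ∈ S, v i h = 0 := by
  obtain ⟨f, h0, h1, h2, h3⟩ := h
  refine ⟨_, norm_normalize h0, fun i => ?_, by simp [h2], fun i hi => by simp [h3 i hi]⟩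
  rw [map_smul, smul_eq_mul]
  exact mul_nonneg (by positivity) (h1 i)

theorem FaceWithout.exists_norm (h : FaceWithout v y S) :
    ∃ h : W, ‖h‖ = 1 ∧ (∀ i, 0 ≤ v i h) ∧ 0 ≤ y h ∧ ∀ i ∈ S, v i h = 0 := by
  obtain ⟨f, h0, h1, h2, h3⟩ := h
  refine ⟨_, norm_normalize h0, fun i => ?_, ?_, fun i hi => by simp [h3 i hi]⟩
  · rw [map_smul, smul_eq_mul]
    exact mul_nonneg (by positivity) (h1 i)
  · rw [map_smul, smul_eq_mul]
    exact mul_nonneg (by positivity) h2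

variable [FiniteDimensional ℝ W]

/-- Compactness of the unit sphere: witnesses for arbitrarily small s accumulate at a nonzero
vector. The clauses of a lexicographic step that pass from new faces to faces of `v` or `l` come
from this limit. -/
theorem exists_limit {Q : ℝ → W → Prop}
    (hQ : ∃ᶠ s in 𝓝[>] (0 : ℝ), ∃ h, ‖h‖ = 1 ∧ Q s h) :
    ∃ (s : ℕ → ℝ) (u : ℕ → W) (h : W), Tendsto s atTop (𝓝 0) ∧ (∀ n, 0 < s n) ∧
      Tendsto u atTop (𝓝 h) ∧ h ≠ 0 ∧ ∀ n, Q (s n) (u n) := by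
  obtain ⟨s, hs, hs'⟩ := exists_seq_forall_of_frequently
    (hQ.and_eventually (self_mem_nhdsWithin : ∀ᶠ s in 𝓝[>] (0 : ℝ), s ∈ Set.Ioi 0))
  choose u hu hu' using fun n => (hs' n).1
  obtain ⟨h, hh, φ, hφ, hlim⟩ := (isCompact_sphere (0 : W) 1).tendsto_subseq
    (x := u) fun n => by simp [hu n]
  refine ⟨s ∘ φ, u ∘ φ, h, ?_, fun n => (hs' _).2, hlim, ?_, fun n => hu' _⟩
  · exact (hs.mono_right nhdsWithin_le_nhds).comp hφ.tendsto_atTop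
  · rintro rfl
    simp at hh

theorem tendsto_apply (f : W →ₗ[ℝ] ℝ) {u : ℕ → W} {h : W} (hu : Tendsto u atTop (𝓝 h)) :
    Tendsto (fun n => f (u n)) atTop (𝓝 (f h)) :=
  (f.continuous_of_finiteDimensional.tendsto h).comp hu

theorem tendsto_lexVec {u : ℕ → W} {h : W} {s : ℕ → ℝ} (hs : Tendsto s atTop (𝓝 0))
    (hu : Tendsto u atTop (𝓝 h)) :
    Tendsto (fun n => lexVec v a b l (s n) (u n)) atTop (𝓝 (v a h)) := by
  have := ((tendsto_apply (v a) hu).sub (hs.mul (tendsto_apply (v b) hu))).add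
    ((hs.pow 2).mul (tendsto_apply l hu))
  simpa [lexVec_apply] using this

section Limits

/-- The limit of the witnesses for faces containing the new vector. -/
theorem exists_limit_faceWith
    (hf : ∃ᶠ s in 𝓝[>] (0 : ℝ), FaceWith v (lexVec v a b l s) S) :
    ∃ h : W, h ≠ 0 ∧ (∀ i, 0 ≤ v i h) ∧ v a h = 0 ∧ (∀ i ∈ S, v i h = 0) ∧
      (b ∈ S → l h ≤ 0) := by
  obtain ⟨s, u, h, hs, hpos, hu, h0, hQ⟩ := exists_limit (hf.mono fun s hs => hs.exists_norm)
  refine ⟨h, h0, fun i => ge_of_tendsto' (tendsto_apply (v i) hu) fun n => (hQ n).1 i, ?_,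
    fun i hi => ?_, fun hb => ?_⟩
  · refine tendsto_nhds_unique (tendsto_lexVec (a := a) (b := b) (l := l) (v := v) hs hu) ?_
    simp [(hQ _).2.1]
  · refine tendsto_nhds_unique (tendsto_apply (v i) hu) ?_
    simp [(hQ _).2.2 i hi]
  · refine le_of_tendsto' (tendsto_apply l hu) fun n => ?_
    obtain ⟨h1, h2, h3⟩ := hQ n
    rw [lexVec_apply, h3 b hb] at h2
    have := h1 a
    have hs2 : 0 < s n ^ 2 := pow_pos (hpos n) 2
    -- With `v b` zero, the equation reads v a u + s² l u = 0 where v a u ≥ 0.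
    by_contra! hc
    nlinarith [mul_pos hs2 hc]

/-- The limit of the witnesses for faces that contain `a` but not the new vector. -/
theorem exists_limit_faceWithout (ha : a ∈ S)
    (hf : ∃ᶠ s in 𝓝[>] (0 : ℝ), FaceWithout v (lexVec v a b l s) S) :
    ∃ h : W, h ≠ 0 ∧ (∀ i, 0 ≤ v i h) ∧ (∀ i ∈ S, v i h = 0) ∧ v b h = 0 ∧ 0 ≤ l h := by
  obtain ⟨s, u, h, hs, hpos, hu, h0, hQ⟩ := exists_limit (hf.mono fun s hs => hs.exists_norm)
  have hn : ∀ i, 0 ≤ v i h := fun i =>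
    ge_of_tendsto' (tendsto_apply (v i) hu) fun n => (hQ n).1 i
  have hbl : ∀ n, v b (u n) ≤ s n * l (u n) := by
    intro n
    obtain ⟨h1, h2, h3⟩ := hQ n
    rw [lexVec_apply, h3 a ha] at h2
    have := hpos n
    by_contra! hc
    nlinarith [mul_pos this (sub_pos.2 hc)]
  refine ⟨h, h0, hn, fun i hi => ?_, le_antisymm ?_ (hn b), ?_⟩
  · refine tendsto_nhds_unique (tendsto_apply (v i) hu) ?_
    simp [(hQ _).2.2 i hi]
  · have := le_of_tendsto_of_tendsto' (tendsto_apply (v b) hu)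
      (hs.mul (tendsto_apply l hu)) hbl
    simpa using this
  · refine ge_of_tendsto' (tendsto_apply l hu) fun n => ?_
    have h1 := ((hQ n).1 b).trans (hbl n)
    exact nonneg_of_mul_nonneg_right h1 (hpos n)

end Limits

variable [Fintype ι]

theorem eventually_faceWithout_of_isFace (hv : GenPos v d) (ha : a ∉ S) (hS : IsFace v S) :
    ∀ᶠ s in 𝓝[>] (0 : ℝ), FaceWithout v (lexVec v a b l s) S := by
  obtain ⟨h, h1, h2⟩ := hS.exists_strict hv
  have hpos := h2 a ha
  have key : Tendsto (fun s : ℝ => lexVec v a b l s h) (𝓝[>] 0) (𝓝 (v a h)) := by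
    have : Continuous fun s : ℝ => v a h - s * v b h + s ^ 2 * l h := by fun_prop
    simpa [lexVec_apply] using (this.tendsto 0).mono_left nhdsWithin_le_nhds
  filter_upwards [key.eventually (lt_mem_nhds hpos)] with s hs
  refine ⟨h, ?_, fun i => ?_, hs.le, h1⟩
  · rintro rfl
    simp at hpos
  · by_cases hi : i ∈ S
    · exact (h1 i hi).ge
    · exact (h2 i hi).le

/-- Perturbation of a witness vanishing on `S` into one that vanishes on the new vector also. -/
theorem eventually_faceWith_of_perturb {h g : W} {t : ℝ → ℝ} {c : ι} (h0 : h ≠ 0)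
    (hc : v c h = 0) (hcS : c ∉ S)
    (hS : ∀ i ∈ S, v i h = 0) (hpos : ∀ i ∉ S, i ≠ c → 0 < v i h)
    (hgS : ∀ i ∈ S, v i g = 0) (hgc : v c g = 1)
    (ht : Tendsto t (𝓝[>] 0) (𝓝 0)) (ht0 : ∀ᶠ s in 𝓝[>] (0 : ℝ), 0 ≤ t s) :
    ∀ᶠ s in 𝓝[>] (0 : ℝ), lexVec v a b l s (h + t s • g) = 0 →
      FaceWith v (lexVec v a b l s) S := by
  have hlim : Tendsto (fun s => h + t s • g) (𝓝[>] 0) (𝓝 h) := by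
    simpa using tendsto_const_nhds.add (ht.smul_const g)
  have h1 : ∀ᶠ s in 𝓝[>] (0 : ℝ), h + t s • g ≠ 0 := hlim.eventually_ne h0
  have h2 : ∀ i, ∀ᶠ s in 𝓝[>] (0 : ℝ), 0 ≤ v i (h + t s • g) := by
    intro i
    by_cases hi : i ∈ S
    · simp [hS i hi, hgS i hi]
    by_cases hic : i = c
    · subst hic
      filter_upwards [ht0] with s hs
      simpa [hc, hgc] using hs
    · have := ((v i).continuous_of_finiteDimensional.tendsto h).comp hlim
      filter_upwards [this.eventually (lt_mem_nhds (hpos i hi hic))] with s hs using hs.le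
  filter_upwards [h1, eventually_all.2 h2] with s hs1 hs2 hs3
  exact ⟨_, hs1, hs2, hs3, fun i hi => by simp [hS i hi, hgS i hi]⟩

variable [DecidableEq ι]

/-- At a strict witness h for S ∪ {a} the new vector has value -s (v b h - s l h), which is negative
for small s. Raising the value at a from 0 by a small amount brings it back to 0; the function t
below is the solution of that linear equation. -/
theorem eventually_faceWith_of_isFace (hv : GenPos v d) (ha : a ∉ S) (hb : b ∉ S) (hab : a ≠ b)
    (hS : IsFace v (insert a S)) :
    ∀ᶠ s in 𝓝[>] (0 : ℝ), FaceWith v (lexVec v a b l s) S := by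
  obtain ⟨h, h1, h2⟩ := hS.exists_strict hv
  have hb' : 0 < v b h := h2 b (by simp [hb, hab.symm])
  have h0 : h ≠ 0 := by rintro rfl; simp at hb'
  obtain ⟨g, hg⟩ := hv.exists_eval_eq (S := insert a S) ((hv.card_le h0 h1).trans (by omega))
    fun i => if i = a then 1 else 0
  have hga : v a g = 1 := by simpa using hg a (by simp)
  have hgS : ∀ i ∈ S, v i g = 0 := by
    intro i hi
    rw [hg i (by simp [hi]), if_neg]
    rintro rfl
    exact ha hi
  have hden : Tendsto (fun s : ℝ => lexVec v a b l s g) (𝓝[>] 0) (𝓝 1) := by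
    have : Continuous fun s : ℝ => v a g - s * v b g + s ^ 2 * l g := by fun_prop
    simpa [lexVec_apply, hga] using (this.tendsto 0).mono_left nhdsWithin_le_nhds
  have hnum : Tendsto (fun s : ℝ => v b h - s * l h) (𝓝[>] 0) (𝓝 (v b h)) := by
    have : Continuous fun s : ℝ => v b h - s * l h := by fun_prop
    simpa using (this.tendsto 0).mono_left nhdsWithin_le_nhds
  have hid : Tendsto (fun s : ℝ => s) (𝓝[>] 0) (𝓝 0) := tendsto_id.mono_right nhdsWithin_le_nhds
  have hden0 : ∀ᶠ s in 𝓝[>] (0 : ℝ), 0 < lexVec v a b l s g :=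
    hden.eventually (lt_mem_nhds one_pos)
  have ht : Tendsto (fun s : ℝ => s * (v b h - s * l h) / lexVec v a b l s g) (𝓝[>] 0) (𝓝 0) := by
    have := (hid.mul hnum).div hden one_ne_zero
    simp only [zero_mul, zero_div] at this
    exact this
  filter_upwards [eventually_faceWith_of_perturb (a := a) (b := b) (l := l) h0 (h1 a (by simp)) ha
    (fun i hi => h1 i (by simp [hi])) (fun i hi hia => h2 i (by simp [hi, hia])) hgS hga ht (by
      filter_upwards [hden0, hnum.eventually (lt_mem_nhds hb'), self_mem_nhdsWithin]
        with s hs1 hs2 hs3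
      exact div_nonneg (mul_nonneg (le_of_lt hs3) hs2.le) hs1.le), hden0] with s hs hs'
  apply hs
  rw [map_add, map_smul, smul_eq_mul, div_mul_cancel₀ _ hs'.ne', lexVec_apply, h1 a (by simp)]
  ring

theorem eventually_faceWith_insert (hv : GenPos v d) (ha : a ∉ S) (hab : a ≠ b)
    (hS : IsFace v (insert a (insert b S))) (hl : ¬ FaceWithout v l (insert a (insert b S))) :
    ∀ᶠ s in 𝓝[>] (0 : ℝ), FaceWith v (lexVec v a b l s) (insert b S) := by
  have hcard : ∃ h : W, h ≠ 0 ∧ (∀ i ∈ insert a (insert b S), v i h = 0) ∧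
      ∀ i ∉ insert a (insert b S), 0 < v i h := by
    obtain ⟨h, h1, h2⟩ := hS.exists_strict hv
    -- A strict witness can be zero only if no index lies outside the set; then the original witness
    -- is strict for lack of anything to check.
    by_cases h0 : h = 0
    · subst h0
      obtain ⟨f, f0, f1, f2⟩ := hS
      refine ⟨f, f0, f2, fun i hi => absurd (h2 i hi) (by simp)⟩
    · exact ⟨h, h0, h1, h2⟩
  obtain ⟨h, h0, h1, h2⟩ := hcard
  have hlh : l h < 0 := by
    by_contra! hc
    refine hl ⟨h, h0, fun i => ?_, hc, h1⟩
    by_cases hi : i ∈ insert a (insert b S)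
    · exact (h1 i hi).ge
    · exact (h2 i hi).le
  obtain ⟨g, hg⟩ := hv.exists_eval_eq (S := insert a (insert b S))
    ((hv.card_le h0 h1).trans (by omega)) fun i => if i = a then 1 else 0
  have hga : v a g = 1 := by simpa using hg a (by simp)
  have haS : a ∉ insert b S := by simp [ha, hab]
  have hgS : ∀ i ∈ insert b S, v i g = 0 := by
    intro i hi
    rw [hg i (Finset.mem_insert_of_mem hi), if_neg]
    rintro rfl
    exact haS hi
  have hden : Tendsto (fun s : ℝ => lexVec v a b l s g) (𝓝[>] 0) (𝓝 1) := by
    have : Continuous fun s : ℝ => v a g - s * v b g + s ^ 2 * l g := by fun_prop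
    simpa [lexVec_apply, hga] using (this.tendsto 0).mono_left nhdsWithin_le_nhds
  have hid : Tendsto (fun s : ℝ => s) (𝓝[>] 0) (𝓝 0) := tendsto_id.mono_right nhdsWithin_le_nhds
  have hden0 : ∀ᶠ s in 𝓝[>] (0 : ℝ), 0 < lexVec v a b l s g :=
    hden.eventually (lt_mem_nhds one_pos)
  have ht : Tendsto (fun s : ℝ => s ^ 2 * (- l h) / lexVec v a b l s g) (𝓝[>] 0) (𝓝 0) := by
    have := ((hid.pow 2).mul_const (- l h)).div hden one_ne_zero
    simp only [ne_eq, OfNat.ofNat_ne_zero, not_false_eq_true, zero_pow, zero_mul, zero_div] at this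
    exact this
  filter_upwards [eventually_faceWith_of_perturb (a := a) (b := b) (l := l) h0 (h1 a (by simp)) haS
    (fun i hi => h1 i (Finset.mem_insert_of_mem hi))
    (fun i hi hia => h2 i (by rw [Finset.mem_insert]; tauto)) hgS hga ht (by
      filter_upwards [hden0] with s hs1
      exact div_nonneg (mul_nonneg (sq_nonneg s) (by linarith)) hs1.le), hden0] with s hs hs'
  apply hs
  rw [map_add, map_smul, smul_eq_mul, div_mul_cancel₀ _ hs'.ne', lexVec_apply, h1 a (by simp),
    h1 b (by simp)]
  ring

/-- Here s² l is positive at the strict witness, so the value at b is raised instead: it enters with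
coefficient -s, and t = s l h / (1 - s l g) makes the sum vanish. -/
theorem eventually_faceWith_insert_left (hl : GenPos (extend v l) d) (hv : GenPos v d)
    (hb : b ∉ S) (hab : a ≠ b) (hS : FaceWithout v l (insert a (insert b S))) :
    ∀ᶠ s in 𝓝[>] (0 : ℝ), FaceWith v (lexVec v a b l s) (insert a S) := by
  obtain ⟨h, h1, h2, h3⟩ := hS.exists_strict hl
  have h0 : h ≠ 0 := by rintro rfl; simp at h3
  obtain ⟨g, hg⟩ := hv.exists_eval_eq (S := insert a (insert b S))
    ((hv.card_le h0 h1).trans (by omega)) fun i => if i = b then 1 else 0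
  have hgb : v b g = 1 := by simpa using hg b (by simp)
  have hbS : b ∉ insert a S := by simp [hb, hab.symm]
  have hgS : ∀ i ∈ insert a S, v i g = 0 := by
    intro i hi
    rw [hg i (by simp at hi ⊢; tauto), if_neg]
    rintro rfl
    exact hbS hi
  have hden : Tendsto (fun s : ℝ => 1 - s * l g) (𝓝[>] 0) (𝓝 1) := by
    have : Continuous fun s : ℝ => 1 - s * l g := by fun_prop
    simpa using (this.tendsto 0).mono_left nhdsWithin_le_nhds
  have hid : Tendsto (fun s : ℝ => s) (𝓝[>] 0) (𝓝 0) := tendsto_id.mono_right nhdsWithin_le_nhds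
  have hden0 : ∀ᶠ s in 𝓝[>] (0 : ℝ), 0 < 1 - s * l g := hden.eventually (lt_mem_nhds one_pos)
  have ht : Tendsto (fun s : ℝ => s * l h / (1 - s * l g)) (𝓝[>] 0) (𝓝 0) := by
    have := (hid.mul_const (l h)).div hden one_ne_zero
    simp only [zero_mul, zero_div] at this
    exact this
  filter_upwards [eventually_faceWith_of_perturb (a := a) (b := b) (l := l) h0 (h1 b (by simp)) hbS
    (fun i hi => h1 i (by simp at hi ⊢; tauto))
    (fun i hi hia => h2 i (by simp at hi ⊢; tauto)) hgS hgb ht (by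
      filter_upwards [hden0, self_mem_nhdsWithin] with s hs1 hs2
      exact div_nonneg (mul_nonneg (le_of_lt hs2) h3.le) hs1.le), hden0] with s hs hs'
  apply hs
  rw [map_add, map_smul, smul_eq_mul, lexVec_apply, lexVec_apply, h1 a (by simp),
    h1 b (by simp), hgS a (by simp), hgb]
  field_simp
  ring

end Lex

end VectorConfig

/-! ### The face complex of a lexicographic extension along a flag -/

namespace VectorConfig

/-- The faces of the configuration extended by `y` that contain `F`, in the case that `y` is a
small perturbation `v a - s • v b + s ^ 2 • l` of `v a`: they are determined by the old faces and
by the new faces containing `a` and `b`. -/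
structure LexStep {W ι : Type*} [AddCommGroup W] [Module ℝ W] [DecidableEq ι]
    (v : ι → W →ₗ[ℝ] ℝ) (y : W →ₗ[ℝ] ℝ) (a b : ι) (F : Finset ι) : Prop where
  faceWithout : ∀ S, F ⊆ S → a ∉ S → IsFace v S → FaceWithout v y S
  faceWith : ∀ S, F ⊆ S → a ∉ S → b ∉ S → IsFace v (insert a S) → FaceWith v y S
  isFace : ∀ S, F ⊆ S → FaceWith v y S → IsFace v (insert a S)
  faceWith_right : ∀ S, F ⊆ S → a ∉ S → b ∉ S → IsFace v (insert a (insert b S)) →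
    ¬ FaceWithout v y (insert a (insert b S)) → FaceWith v y (insert b S)
  faceWith_both : ∀ S, F ⊆ S → FaceWith v y (insert b S) →
    FaceWithout v y (insert a (insert b S)) → FaceWith v y (insert a (insert b S))
  faceWith_left : ∀ S, F ⊆ S → a ∉ S → b ∉ S → FaceWithout v y (insert a (insert b S)) →
    FaceWith v y (insert a S)
  faceWithout_both : ∀ S, F ⊆ S → FaceWithout v y (insert a S) →
    FaceWithout v y (insert a (insert b S))

/-- The faces of the configuration extended by a lexicographic extension along a flag. -/
def LexChain {W ι : Type*} [AddCommGroup W] [Module ℝ W] [DecidableEq ι]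
    (v : ι → W →ₗ[ℝ] ℝ) (y : W →ₗ[ℝ] ℝ) : List (ι × ι) → Finset ι → Prop
  | [], F => (∀ S, F ⊆ S → IsFace v S → FaceWithout v y S) ∧ ∀ S, F ⊆ S → ¬ FaceWith v y S
  | (a, b) :: L, F => LexStep v y a b F ∧ LexChain v y L (insert a (insert b F))

section Apply

variable {W ι : Type*} [AddCommGroup W] [Module ℝ W]
  {v : ι → W →ₗ[ℝ] ℝ} {l : W →ₗ[ℝ] ℝ} {a b : ι}

theorem lexVec_apply_of_eq_zero {s : ℝ} {h : W} (ha : v a h = 0) (hb : v b h = 0) :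
    lexVec v a b l s h = s ^ 2 * l h := by
  simp [lexVec, ha, hb]

theorem eventually_lexVec_ne_zero {h : W} (hh : v a h ≠ 0 ∨ v b h ≠ 0 ∨ l h ≠ 0) :
    ∀ᶠ s in 𝓝[>] (0 : ℝ), lexVec v a b l s h ≠ 0 := by
  have e : ∀ s, lexVec v a b l s h = v a h - s * v b h + s ^ 2 * l h := fun s => by simp [lexVec]
  simp only [e]
  by_cases ha : v a h = 0
  · by_cases hb : v b h = 0
    · have hl : l h ≠ 0 := by tauto
      filter_upwards [self_mem_nhdsWithin] with s hs
      have : s ≠ 0 := ne_of_gt hs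
      simp [ha, hb, hl, this]
    · have : Tendsto (fun s : ℝ => - v b h + s * l h) (𝓝[>] 0) (𝓝 (- v b h)) := by
        have : Continuous fun s : ℝ => - v b h + s * l h := by fun_prop
        simpa using (this.tendsto 0).mono_left nhdsWithin_le_nhds
      filter_upwards [self_mem_nhdsWithin, this.eventually_ne (neg_ne_zero.2 hb)] with s hs hs'
      have hs0 : s ≠ 0 := ne_of_gt hs
      have : v a h - s * v b h + s ^ 2 * l h = s * (- v b h + s * l h) := by rw [ha]; ring
      rw [this]
      exact mul_ne_zero hs0 hs'
  · have : Tendsto (fun s : ℝ => v a h - s * v b h + s ^ 2 * l h) (𝓝[>] 0) (𝓝 (v a h)) := by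
      have : Continuous fun s : ℝ => v a h - s * v b h + s ^ 2 * l h := by fun_prop
      simpa using (this.tendsto 0).mono_left nhdsWithin_le_nhds
    exact this.eventually_ne ha

theorem faceWithout_lexVec_iff {s : ℝ} (hs : 0 < s) {S : Finset ι} (ha : a ∈ S) (hb : b ∈ S) :
    FaceWithout v (lexVec v a b l s) S ↔ FaceWithout v l S := by
  constructor <;> rintro ⟨h, h0, h1, h2, h3⟩ <;> refine ⟨h, h0, h1, ?_, h3⟩
  · rw [lexVec_apply_of_eq_zero (h3 a ha) (h3 b hb)] at h2
    exact nonneg_of_mul_nonneg_right h2 (by positivity)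
  · rw [lexVec_apply_of_eq_zero (h3 a ha) (h3 b hb)]
    positivity

theorem faceWith_lexVec_iff {s : ℝ} (hs : 0 < s) {S : Finset ι} (ha : a ∈ S) (hb : b ∈ S) :
    FaceWith v (lexVec v a b l s) S ↔ FaceWith v l S := by
  constructor <;> rintro ⟨h, h0, h1, h2, h3⟩ <;> refine ⟨h, h0, h1, ?_, h3⟩
  · rw [lexVec_apply_of_eq_zero (h3 a ha) (h3 b hb)] at h2
    simpa [hs.ne'] using h2
  · rw [lexVec_apply_of_eq_zero (h3 a ha) (h3 b hb), h2, mul_zero]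

end Apply

section Congr

variable {W ι : Type*} [AddCommGroup W] [Module ℝ W] [DecidableEq ι]
  {v : ι → W →ₗ[ℝ] ℝ} {y l : W →ₗ[ℝ] ℝ} {a b : ι} {F F' : Finset ι}

theorem LexStep.congr (h : LexStep v l a b F) (hF : F ⊆ F')
    (h1 : ∀ S, F' ⊆ S → (FaceWithout v y S ↔ FaceWithout v l S))
    (h2 : ∀ S, F' ⊆ S → (FaceWith v y S ↔ FaceWith v l S)) : LexStep v y a b F' := by
  have e1 : ∀ {c S}, F' ⊆ S → F' ⊆ insert c S := fun hS => hS.trans (Finset.subset_insert _ _)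
  refine ⟨fun S hS => ?_, fun S hS => ?_, fun S hS => ?_, fun S hS => ?_, fun S hS => ?_,
    fun S hS => ?_, fun S hS => ?_⟩
  · rw [h1 S hS]; exact h.faceWithout S (hF.trans hS)
  · rw [h2 S hS]; exact h.faceWith S (hF.trans hS)
  · rw [h2 S hS]; exact h.isFace S (hF.trans hS)
  · rw [h1 _ (e1 (e1 hS)), h2 _ (e1 hS)]; exact h.faceWith_right S (hF.trans hS)
  · rw [h1 _ (e1 (e1 hS)), h2 _ (e1 hS), h2 _ (e1 (e1 hS))]
    exact h.faceWith_both S (hF.trans hS)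
  · rw [h1 _ (e1 (e1 hS)), h2 _ (e1 hS)]; exact h.faceWith_left S (hF.trans hS)
  · rw [h1 _ (e1 (e1 hS)), h1 _ (e1 hS)]; exact h.faceWithout_both S (hF.trans hS)

theorem LexChain.congr {L : List (ι × ι)} (h : LexChain v l L F) (hF : F ⊆ F')
    (h1 : ∀ S, F' ⊆ S → (FaceWithout v y S ↔ FaceWithout v l S))
    (h2 : ∀ S, F' ⊆ S → (FaceWith v y S ↔ FaceWith v l S)) : LexChain v y L F' := by
  induction L generalizing F F' with
  | nil =>
    refine ⟨fun S hS => ?_, fun S hS => ?_⟩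
    · rw [h1 S hS]; exact h.1 S (hF.trans hS)
    · rw [h2 S hS]; exact h.2 S (hF.trans hS)
  | cons p L ih =>
    obtain ⟨a, b⟩ := p
    refine ⟨h.1.congr hF h1 h2, ih h.2 ?_ (fun S hS => h1 S ?_) (fun S hS => h2 S ?_)⟩
    · exact Finset.insert_subset_insert _ (Finset.insert_subset_insert _ hF)
    all_goals exact ((Finset.subset_insert _ _).trans (Finset.subset_insert _ _)).trans hS

end Congr

theorem eventually_pos_nhdsGT : ∀ᶠ s in 𝓝[>] (0 : ℝ), 0 < s := self_mem_nhdsWithin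

section GenPos

variable {W ι : Type*} [AddCommGroup W] [Module ℝ W] [Fintype ι] [DecidableEq ι]
  {v : ι → W →ₗ[ℝ] ℝ} {y l : W →ₗ[ℝ] ℝ} {a b : ι} {d : ℕ}

theorem GenPos.extend_of (hv : GenPos v d)
    (hy : ∀ (S : Finset ι) (h : W), S.card = d → (∀ i ∈ S, v i h = 0) → y h = 0 → h = 0) :
    GenPos (extend v y) d := by
  refine ⟨hv.finrank_eq, ?_, fun h S hS hc => ?_⟩
  · simpa using hv.lt_card.trans (Nat.lt_succ_self _)
  · have h1 : ∀ i ∈ Finset.eraseNone S, v i h = 0 := fun i hi => hS (some i) (by simpa using hi)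
    by_cases hn : none ∈ S
    · have hcard : (Finset.eraseNone S).card + 1 = S.card := by
        have := Finset.card_pos.2 ⟨_, hn⟩
        rw [Finset.card_eraseNone_of_mem hn]
        omega
      rcases Nat.lt_or_ge d (Finset.eraseNone S).card with hd | hd
      · exact hv.eq_zero h _ h1 hd
      · exact hy _ h (by omega) h1 (hS none hn)
    · refine hv.eq_zero h _ h1 ?_
      rwa [Finset.card_eraseNone_of_not_mem hn]

/-- The vectors vanishing on d given indices form at most a line, so it suffices that `y s` be
nonzero at one spanning vector for each of finitely many sets. -/
theorem GenPos.eventually_extend (hv : GenPos v d) {y : ℝ → W →ₗ[ℝ] ℝ}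
    (hy : ∀ (S : Finset ι) (h : W), S.card = d → (∀ i ∈ S, v i h = 0) → h ≠ 0 →
      ∀ᶠ s in 𝓝[>] (0 : ℝ), y s h ≠ 0) :
    ∀ᶠ s in 𝓝[>] (0 : ℝ), GenPos (extend v (y s)) d := by
  have key : ∀ S : Finset ι, ∀ᶠ s in 𝓝[>] (0 : ℝ), ∀ h : W, S.card = d → (∀ i ∈ S, v i h = 0) →
      y s h = 0 → h = 0 := by
    intro S
    by_cases hS : ∃ h : W, S.card = d ∧ (∀ i ∈ S, v i h = 0) ∧ h ≠ 0
    · obtain ⟨f, hc, hf, f0⟩ := hS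
      obtain ⟨i, hi⟩ : ∃ i, i ∉ S := by
        by_contra! hall
        have := hv.lt_card
        rw [← Finset.card_univ, ← Finset.eq_univ_of_forall hall] at this
        omega
      have hins : ∀ g : W, (∀ j ∈ S, v j g = 0) → v i g = 0 → g = 0 := by
        intro g hg hig
        refine hv.eq_zero g (insert i S) ?_ (by rw [Finset.card_insert_of_notMem hi]; omega)
        simpa [hig] using hg
      have hif : v i f ≠ 0 := fun h => f0 (hins f hf h)
      filter_upwards [hy S f hc hf f0] with s hs h _ hh hyh
      have hhf : h - (v i h / v i f) • f = 0 := by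
        refine hins _ (fun j hj => by simp [hh j hj, hf j hj]) ?_
        simp [hif]
      rw [sub_eq_zero] at hhf
      rw [hhf, map_smul, smul_eq_mul, mul_eq_zero, or_iff_left hs] at hyh
      rw [hhf, hyh, zero_smul]
    · push Not at hS
      exact Eventually.of_forall fun s h hc hh _ => hS h hc hh
  filter_upwards [eventually_all.2 key] with s hs
  exact hv.extend_of hs

theorem GenPos.eventually_extend_lexVec (hv : GenPos v d) (hl : GenPos (extend v l) d) :
    ∀ᶠ s in 𝓝[>] (0 : ℝ), GenPos (extend v (lexVec v a b l s)) d := by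
  refine hv.eventually_extend fun S h hc hS h0 => eventually_lexVec_ne_zero ?_
  refine Or.inr (Or.inr fun hlh => h0 ?_)
  refine hl.eq_zero h (Finset.insertNone S) ?_ (by simp [hc])
  rintro (_ | i) hi
  · exact hlh
  · exact hS i (by simpa using hi)

/-- Positive combinations of all the `v i` are positive at every witness. With distinct powers of t
as coefficients, the value at a fixed h ≠ 0 is a nonzero polynomial in t, so small t avoid its
roots. -/
theorem exists_generic_interior (hv : GenPos v d) :
    ∃ y : W →ₗ[ℝ] ℝ, GenPos (extend v y) d ∧
      ∀ h : W, h ≠ 0 → (∀ i, 0 ≤ v i h) → 0 < y h := by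
  let e := Fintype.equivFin ι
  let y : ℝ → W →ₗ[ℝ] ℝ := fun t => ∑ i, t ^ (e i : ℕ) • v i
  have hy : ∀ t h, y t h = ∑ i, t ^ (e i : ℕ) * v i h := fun t h => by
    simp [y, LinearMap.sum_apply]
  have hgen : ∀ᶠ t in 𝓝[>] (0 : ℝ), GenPos (extend v (y t)) d := by
    refine hv.eventually_extend fun S h hc hS h0 => ?_
    let p : Polynomial ℝ := ∑ i, Polynomial.monomial (e i : ℕ) (v i h)
    have hp : ∀ t, p.eval t = y t h := by
      intro t
      rw [hy, Polynomial.eval_finsetSum]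
      simp [mul_comm]
    have hp0 : p ≠ 0 := by
      intro hp
      refine h0 (hv.eq_zero h Finset.univ (fun i _ => ?_) (by simpa using hv.lt_card))
      have := congrArg (fun q => Polynomial.coeff q (e i : ℕ)) hp
      simp only [p, Polynomial.finsetSum_coeff, Polynomial.coeff_monomial,
        Polynomial.coeff_zero] at this
      rw [Finset.sum_eq_single i] at this
      · simpa using this
      · intro j _ hj
        rw [if_neg]
        exact fun h => hj (e.injective (Fin.ext h))
      · simp
    have hfin : {t | p.IsRoot t}.Finite := Polynomial.finite_setOfPred_isRoot hp0
    have h1 : {t | p.IsRoot t}ᶜ ∈ 𝓝[≠] (0 : ℝ) := nhdsNE_le_cofinite 0 hfin.compl_mem_cofinite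
    have h2 : 𝓝[>] (0 : ℝ) ≤ 𝓝[≠] 0 := nhdsWithin_mono _ fun x hx => ne_of_gt hx
    filter_upwards [h2 h1] with t ht
    rw [← hp]
    exact ht
  obtain ⟨t, ht, ht0⟩ := (hgen.and eventually_pos_nhdsGT).exists
  refine ⟨y t, ht, fun h h0 hn => ?_⟩
  obtain ⟨i, hi⟩ := hv.exists_pos h0 hn
  rw [hy]
  exact Finset.sum_pos' (fun j _ => mul_nonneg (by positivity) (hn j))
    ⟨i, Finset.mem_univ _, by positivity⟩

end GenPos

section Existence

variable {W ι : Type*} [NormedAddCommGroup W] [NormedSpace ℝ W] [FiniteDimensional ℝ W]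
  [Fintype ι] [DecidableEq ι] {v : ι → W →ₗ[ℝ] ℝ} {d : ℕ}

/-- Each clause holds, set by set, for all sufficiently small s, and there are finitely many sets,
so one s serves all of them. Clauses asserting a face for the new vector use perturbed witnesses;
the remaining ones pass to a limit of witnesses. -/
theorem exists_lexStep (hv : GenPos v d) {a b : ι} (hab : a ≠ b) {l : W →ₗ[ℝ] ℝ}
    (hl : GenPos (extend v l) d) :
    ∃ s : ℝ, 0 < s ∧ GenPos (extend v (lexVec v a b l s)) d ∧
      LexStep v (lexVec v a b l s) a b ∅ := by
  have h1 : ∀ S : Finset ι, ∀ᶠ s in 𝓝[>] (0 : ℝ), a ∉ S → IsFace v S →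
      FaceWithout v (lexVec v a b l s) S := by
    intro S
    simp only [eventually_imp_distrib_left]
    exact fun ha hS => eventually_faceWithout_of_isFace hv ha hS
  have h2 : ∀ S : Finset ι, ∀ᶠ s in 𝓝[>] (0 : ℝ), a ∉ S → b ∉ S → IsFace v (insert a S) →
      FaceWith v (lexVec v a b l s) S := by
    intro S
    simp only [eventually_imp_distrib_left]
    exact fun ha hb hS => eventually_faceWith_of_isFace hv ha hb hab hS
  have h3 : ∀ S : Finset ι, ∀ᶠ s in 𝓝[>] (0 : ℝ), FaceWith v (lexVec v a b l s) S →
      IsFace v (insert a S) := by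
    intro S
    by_contra hc
    have hc' : ∃ᶠ s in 𝓝[>] (0 : ℝ), FaceWith v (lexVec v a b l s) S ∧ ¬ IsFace v (insert a S) := by
      exact (not_eventually.1 hc).mono fun s hs => by tauto
    obtain ⟨h, h0, h1, h2, h3, -⟩ := exists_limit_faceWith (hc'.mono fun s hs => hs.1)
    obtain ⟨_, -, hn⟩ := hc'.exists
    refine hn ⟨h, h0, h1, ?_⟩
    simpa [h2] using h3
  have h4 : ∀ S : Finset ι, ∀ᶠ s in 𝓝[>] (0 : ℝ), a ∉ S → b ∉ S →
      IsFace v (insert a (insert b S)) → ¬ FaceWithout v l (insert a (insert b S)) →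
      FaceWith v (lexVec v a b l s) (insert b S) := by
    intro S
    simp only [eventually_imp_distrib_left]
    exact fun ha hb hS hn => eventually_faceWith_insert hv ha hab hS hn
  have h5 : ∀ S : Finset ι, ∀ᶠ s in 𝓝[>] (0 : ℝ), FaceWith v (lexVec v a b l s) (insert b S) →
      FaceWithout v l (insert a (insert b S)) → FaceWith v l (insert a (insert b S)) := by
    intro S
    by_contra hc
    have hc' : ∃ᶠ s in 𝓝[>] (0 : ℝ), FaceWith v (lexVec v a b l s) (insert b S) ∧
        FaceWithout v l (insert a (insert b S)) ∧ ¬ FaceWith v l (insert a (insert b S)) := by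
      exact (not_eventually.1 hc).mono fun s hs => by tauto
    obtain ⟨h, h0, h1, h2, h3, h4⟩ := exists_limit_faceWith (hc'.mono fun s hs => hs.1)
    obtain ⟨_, -, ⟨f, f0, f1, f2, f3⟩, hn⟩ := hc'.exists
    have hS : ∀ i ∈ insert a (insert b S), v i h = 0 := by
      intro i hi
      rcases Finset.mem_insert.1 hi with rfl | hi
      · exact h2
      · exact h3 i hi
    rcases (h4 (by simp)).eq_or_lt with hl0 | hl0
    · exact hn ⟨h, h0, h1, hl0, hS⟩
    -- The limit h has l h < 0 and the old witness f has l f ≥ 0, so this nonnegative combination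
    -- annihilates l. It is nonzero because f is positive somewhere.
    · refine hn ⟨l f • h - l h • f, ?_, fun i => ?_, ?_, fun i hi => ?_⟩
      · obtain ⟨i, hi⟩ := hv.exists_pos f0 f1
        intro he
        have := congrArg (v i) he
        simp only [map_sub, map_smul, smul_eq_mul, map_zero] at this
        nlinarith [mul_nonneg f2 (h1 i), mul_pos (neg_pos.2 hl0) hi]
      · simp only [map_sub, map_smul, smul_eq_mul]
        nlinarith [mul_nonneg f2 (h1 i), mul_nonneg (neg_pos.2 hl0).le (f1 i)]
      · simp only [map_sub, map_smul, smul_eq_mul]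
        ring
      · simp [hS i hi, f3 i hi]
  have h6 : ∀ S : Finset ι, ∀ᶠ s in 𝓝[>] (0 : ℝ), a ∉ S → b ∉ S →
      FaceWithout v l (insert a (insert b S)) → FaceWith v (lexVec v a b l s) (insert a S) := by
    intro S
    simp only [eventually_imp_distrib_left]
    exact fun ha hb hS => eventually_faceWith_insert_left hl hv hb hab hS
  have h7 : ∀ S : Finset ι, ∀ᶠ s in 𝓝[>] (0 : ℝ), FaceWithout v (lexVec v a b l s) (insert a S) →
      FaceWithout v l (insert a (insert b S)) := by
    intro S
    by_contra hc
    have hc' : ∃ᶠ s in 𝓝[>] (0 : ℝ), FaceWithout v (lexVec v a b l s) (insert a S) ∧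
        ¬ FaceWithout v l (insert a (insert b S)) := by
      exact (not_eventually.1 hc).mono fun s hs => by tauto
    obtain ⟨h, h0, h1, h2, h3, h4⟩ :=
      exists_limit_faceWithout (by simp) (hc'.mono fun s hs => hs.1)
    obtain ⟨_, -, hn⟩ := hc'.exists
    refine hn ⟨h, h0, h1, h4, fun i hi => ?_⟩
    rcases Finset.mem_insert.1 hi with rfl | hi
    · exact h2 _ (by simp)
    rcases Finset.mem_insert.1 hi with rfl | hi
    · exact h3
    · exact h2 i (by simp [hi])
  obtain ⟨s, hg, hs, k1, k2, k3, k4, k5, k6, k7⟩ :=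
    ((hv.eventually_extend_lexVec (a := a) (b := b) hl).and
      (eventually_pos_nhdsGT.and
      ((eventually_all.2 h1).and ((eventually_all.2 h2).and ((eventually_all.2 h3).and
      ((eventually_all.2 h4).and ((eventually_all.2 h5).and ((eventually_all.2 h6).and
      (eventually_all.2 h7))))))))).exists
  refine ⟨s, hs, hg, ⟨fun S _ => k1 S, fun S _ => k2 S, fun S _ => k3 S, fun S _ => ?_,
    fun S _ => ?_, fun S _ => ?_, fun S _ => ?_⟩⟩
  · rw [faceWithout_lexVec_iff hs (by simp) (by simp)]; exact k4 S
  · rw [faceWithout_lexVec_iff hs (by simp) (by simp),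
      faceWith_lexVec_iff (S := insert a (insert b S)) hs (by simp) (by simp)]
    exact k5 S
  · rw [faceWithout_lexVec_iff hs (by simp) (by simp)]; exact k6 S
  · rw [faceWithout_lexVec_iff (S := insert a (insert b S)) hs (by simp) (by simp)]; exact k7 S

/-- The flag is processed from its end: l is fixed first and s is then chosen small in terms of l.
Over sets containing a and b the new vector is s² l on every witness, so the chain for l carries
over unchanged. -/
theorem exists_lexChain (hv : GenPos v d) (L : List (ι × ι)) (hL : ∀ p ∈ L, p.1 ≠ p.2) :
    ∃ y : W →ₗ[ℝ] ℝ, GenPos (extend v y) d ∧ LexChain v y L ∅ := by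
  induction L with
  | nil =>
    obtain ⟨y, hy, hpos⟩ := exists_generic_interior hv
    refine ⟨y, hy, fun S _ hS => ?_, fun S _ hS => ?_⟩
    · obtain ⟨h, h0, h1, h2⟩ := hS
      exact ⟨h, h0, h1, (hpos h h0 h1).le, h2⟩
    · obtain ⟨h, h0, h1, h2, -⟩ := hS
      exact (hpos h h0 h1).ne' h2
  | cons p L ih =>
    obtain ⟨a, b⟩ := p
    obtain ⟨l, hl, hc⟩ := ih fun q hq => hL q (by simp [hq])
    obtain ⟨s, hs, hg, hstep⟩ := exists_lexStep hv (hL (a, b) (by simp)) hl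
    refine ⟨_, hg, hstep, hc.congr (Finset.empty_subset _) (fun S hS => ?_) fun S hS => ?_⟩
    · exact faceWithout_lexVec_iff hs (hS (by simp)) (hS (by simp))
    · exact faceWith_lexVec_iff hs (hS (by simp)) (hS (by simp))

end Existence

end VectorConfig

/-! ### Good flags and their survival under extension -/

namespace VectorConfig

/-- All sets `F ∪ G` with `G` of size at most `k` are faces. -/
def LinkNeighborly {W ι : Type*} [AddCommGroup W] [Module ℝ W] [DecidableEq ι]
    (v : ι → W →ₗ[ℝ] ℝ) (F : Finset ι) (k : ℕ) : Prop :=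
  ∀ G : Finset ι, G.card ≤ k → IsFace v (F ∪ G)

/-- The minimal nonfaces of the link of `F` have at most `k + 1` elements. -/
def LinkMissing {W ι : Type*} [AddCommGroup W] [Module ℝ W] [DecidableEq ι]
    (v : ι → W →ₗ[ℝ] ℝ) (F : Finset ι) (k : ℕ) : Prop :=
  ∀ G : Finset ι, ¬ IsFace v (F ∪ G) → ∃ M ⊆ G, M.card ≤ k + 1 ∧ ¬ IsFace v (F ∪ M)

/-- The minimal nonfaces of the link of `F` that contain `c` have at most `k + 2` elements. -/
def LinkMissingAt {W ι : Type*} [AddCommGroup W] [Module ℝ W] [DecidableEq ι]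
    (v : ι → W →ₗ[ℝ] ℝ) (F : Finset ι) (c : ι) (k : ℕ) : Prop :=
  ∀ G : Finset ι, IsFace v (F ∪ G) → ¬ IsFace v (insert c (F ∪ G)) →
    ∃ M ⊆ G, M.card ≤ k + 1 ∧ ¬ IsFace v (insert c (F ∪ M))

/-- A flag of universal faces along which the configuration can be extended. -/
inductive GoodFlag {W ι : Type*} [AddCommGroup W] [Module ℝ W] [DecidableEq ι]
    (v : ι → W →ₗ[ℝ] ℝ) : Finset ι → ℕ → List (ι × ι) → Prop
  | base {F : Finset ι} {a b : ι} (hab : a ≠ b) (ha : a ∉ F) (hb : b ∉ F)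
      (hN : LinkNeighborly v F 1) (hM : LinkMissing v F 1)
      (hN' : LinkNeighborly v (insert a (insert b F)) 0) : GoodFlag v F 1 [(a, b)]
  | single {F : Finset ι} {a b : ι} {k : ℕ} {L : List (ι × ι)} (hab : a ≠ b) (ha : a ∉ F)
      (hb : b ∉ F) (hN : LinkNeighborly v F (k + 1)) (hM : LinkMissing v F (k + 1))
      (hG : GoodFlag v (insert a (insert b F)) k L) : GoodFlag v F (k + 1) ((a, b) :: L)
  | double {F : Finset ι} {a b c d : ι} {k : ℕ} {L : List (ι × ι)} (hab : a ≠ b) (ha : a ∉ F)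
      (hb : b ∉ F) (hcd : c ≠ d) (hc : c ∉ insert a (insert b F)) (hd : d ∉ insert a (insert b F))
      (hN : LinkNeighborly v F (k + 2)) (hM : LinkMissing v F (k + 2))
      (hN' : LinkNeighborly v (insert a (insert b F)) (k + 1))
      (hH : LinkMissingAt v (insert a (insert b F)) c k)
      (hG : GoodFlag v (insert c (insert d (insert a (insert b F)))) k L) :
      GoodFlag v F (k + 2) ((a, b) :: (c, d) :: L)

section Extend

variable {W ι : Type*} [AddCommGroup W] [Module ℝ W]
  {v : ι → W →ₗ[ℝ] ℝ} {y : W →ₗ[ℝ] ℝ} {F : Finset ι}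

theorem card_eraseNone_add_one {T : Finset (Option ι)} (hT : none ∈ T) :
    (Finset.eraseNone T).card + 1 = T.card := by
  have := Finset.card_pos.2 ⟨_, hT⟩
  rw [Finset.card_eraseNone_of_mem hT]
  omega

theorem isFace_extend_map_iff :
    IsFace (extend v y) (F.map Function.Embedding.some) ↔ FaceWithout v y F := by
  rw [isFace_extend_of_notMem (by simp), Finset.eraseNone_map_some]

theorem isFace_extend_insertNone_iff :
    IsFace (extend v y) (Finset.insertNone F) ↔ FaceWith v y F := by
  rw [isFace_extend_of_mem (by simp), Finset.eraseNone_insertNone]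

end Extend

section Flags

variable {W ι : Type*} [AddCommGroup W] [Module ℝ W] [DecidableEq ι]
  {v : ι → W →ₗ[ℝ] ℝ} {y : W →ₗ[ℝ] ℝ} {F : Finset ι} {a b c : ι} {k : ℕ} {L : List (ι × ι)}

theorem GoodFlag.linkNeighborly (h : GoodFlag v F k L) : LinkNeighborly v F k := by
  cases h <;> assumption

theorem GoodFlag.linkMissing (h : GoodFlag v F k L) : LinkMissing v F k := by
  cases h <;> assumption

theorem GoodFlag.ne (h : GoodFlag v F k L) : ∀ p ∈ L, p.1 ≠ p.2 := by
  induction h with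
  | base hab => simpa using hab
  | single hab _ _ _ _ _ ih => simpa using ⟨hab, by simpa using ih⟩
  | double hab _ _ hcd _ _ _ _ _ _ _ ih => simpa using ⟨hab, hcd, by simpa using ih⟩

theorem eraseNone_map_union (F : Finset ι) (T : Finset (Option ι)) :
    Finset.eraseNone (F.map Function.Embedding.some ∪ T) = F ∪ Finset.eraseNone T := by
  ext i; simp

theorem map_union_map (G : Finset ι) : F.map Function.Embedding.some ∪
    G.map Function.Embedding.some = (F ∪ G).map Function.Embedding.some :=
  (Finset.map_union _ _).symm

theorem map_union_insertNone (G : Finset ι) : F.map Function.Embedding.some ∪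
    Finset.insertNone G = Finset.insertNone (F ∪ G) := by
  ext (_ | i) <;> simp

theorem linkNeighborly_extend_iff :
    LinkNeighborly (extend v y) (F.map Function.Embedding.some) k ↔
      (∀ G : Finset ι, G.card ≤ k → FaceWithout v y (F ∪ G)) ∧
      ∀ G : Finset ι, G.card + 1 ≤ k → FaceWith v y (F ∪ G) := by
  constructor
  · refine fun h => ⟨fun G hG => ?_, fun G hG => ?_⟩
    · have := h (G.map Function.Embedding.some) (by simpa using hG)
      rwa [map_union_map, isFace_extend_map_iff] at this
    · have := h (Finset.insertNone G) (by simpa using hG)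
      rwa [map_union_insertNone, isFace_extend_insertNone_iff] at this
  · rintro ⟨h1, h2⟩ T hT
    by_cases hn : none ∈ T
    · rw [isFace_extend_of_mem (by simp [hn]), eraseNone_map_union]
      exact h2 _ (by rwa [card_eraseNone_add_one hn])
    · rw [isFace_extend_of_notMem (by simp [hn]), eraseNone_map_union]
      exact h1 _ ((Finset.card_eraseNone_le _).trans hT)

/-- The new vector counts as one element, so a nonface through it leaves room for only `k` old
indices; a nonface avoiding it may use `k + 1`. -/
theorem linkMissing_extend_iff :
    LinkMissing (extend v y) (F.map Function.Embedding.some) k ↔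
      (∀ G : Finset ι, ¬ FaceWithout v y (F ∪ G) →
        ∃ M ⊆ G, M.card ≤ k + 1 ∧ ¬ FaceWithout v y (F ∪ M)) ∧
      ∀ G : Finset ι, ¬ FaceWith v y (F ∪ G) →
        ∃ M ⊆ G, (M.card ≤ k + 1 ∧ ¬ FaceWithout v y (F ∪ M)) ∨
          (M.card ≤ k ∧ ¬ FaceWith v y (F ∪ M)) := by
  constructor
  · refine fun h => ⟨fun G hG => ?_, fun G hG => ?_⟩
    · obtain ⟨M, hM, hc, hf⟩ := h (G.map Function.Embedding.some)
        (by rwa [map_union_map, isFace_extend_map_iff])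
      have hn : none ∉ M := fun hn => by simpa using hM hn
      refine ⟨Finset.eraseNone M, fun i hi => ?_, (Finset.card_eraseNone_le _).trans hc, ?_⟩
      · simpa using hM (Finset.mem_eraseNone.1 hi)
      · rwa [isFace_extend_of_notMem (by simp [hn]), eraseNone_map_union] at hf
    · obtain ⟨M, hM, hc, hf⟩ := h (Finset.insertNone G)
        (by rwa [map_union_insertNone, isFace_extend_insertNone_iff])
      refine ⟨Finset.eraseNone M, fun i hi => ?_, ?_⟩
      · simpa using hM (Finset.mem_eraseNone.1 hi)
      · by_cases hn : none ∈ M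
        · rw [isFace_extend_of_mem (by simp [hn]), eraseNone_map_union] at hf
          have := card_eraseNone_add_one hn
          exact Or.inr ⟨by omega, hf⟩
        · rw [isFace_extend_of_notMem (by simp [hn]), eraseNone_map_union] at hf
          exact Or.inl ⟨(Finset.card_eraseNone_le _).trans hc, hf⟩
  · rintro ⟨h1, h2⟩ T hT
    by_cases hn : none ∈ T
    · rw [isFace_extend_of_mem (by simp [hn]), eraseNone_map_union] at hT
      obtain ⟨M, hM, ⟨hc, hf⟩ | ⟨hc, hf⟩⟩ := h2 _ hT
      · refine ⟨M.map Function.Embedding.some, ?_, by simpa using hc, ?_⟩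
        · intro o ho
          obtain ⟨i, hi, rfl⟩ := Finset.mem_map.1 ho
          exact Finset.mem_eraseNone.1 (hM hi)
        · rwa [map_union_map, isFace_extend_map_iff]
      · refine ⟨Finset.insertNone M, ?_, by simpa using hc, ?_⟩
        · rintro (_ | i) ho
          · exact hn
          · exact Finset.mem_eraseNone.1 (hM (by simpa using ho))
        · rwa [map_union_insertNone, isFace_extend_insertNone_iff]
    · rw [isFace_extend_of_notMem (by simp [hn]), eraseNone_map_union] at hT
      obtain ⟨M, hM, hc, hf⟩ := h1 _ hT
      refine ⟨M.map Function.Embedding.some, ?_, by simpa using hc, ?_⟩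
      · intro o ho
        obtain ⟨i, hi, rfl⟩ := Finset.mem_map.1 ho
        exact Finset.mem_eraseNone.1 (hM hi)
      · rwa [map_union_map, isFace_extend_map_iff]

theorem insert_map_some (S : Finset ι) : insert (some c) (S.map Function.Embedding.some) =
    (insert c S).map Function.Embedding.some := by simp

theorem linkMissingAt_extend
    (h1 : ∀ G, FaceWithout v y (F ∪ G) → ¬ FaceWithout v y (insert c (F ∪ G)) →
      ∃ M ⊆ G, M.card ≤ k + 1 ∧ ¬ FaceWithout v y (insert c (F ∪ M)))
    (h2 : ∀ G, FaceWith v y (F ∪ G) → ¬ FaceWith v y (insert c (F ∪ G)) →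
      ∃ M ⊆ G, M.card ≤ k + 1 ∧ ¬ FaceWithout v y (insert c (F ∪ M))) :
    LinkMissingAt (extend v y) (F.map Function.Embedding.some) (some c) k := by
  have key : ∀ (T : Finset (Option ι)) (M : Finset ι), M ⊆ Finset.eraseNone T → M.card ≤ k + 1 →
      ¬ FaceWithout v y (insert c (F ∪ M)) → ∃ M ⊆ T, M.card ≤ k + 1 ∧
        ¬ IsFace (extend v y) (insert (some c) (F.map Function.Embedding.some ∪ M)) := by
    intro T M hM hc hf
    refine ⟨M.map Function.Embedding.some, ?_, by simpa using hc, ?_⟩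
    · intro o ho
      obtain ⟨i, hi, rfl⟩ := Finset.mem_map.1 ho
      exact Finset.mem_eraseNone.1 (hM hi)
    · rwa [map_union_map, insert_map_some, isFace_extend_map_iff]
  have he : ∀ T : Finset (Option ι),
      Finset.eraseNone (insert (some c) (F.map Function.Embedding.some ∪ T)) =
        insert c (F ∪ Finset.eraseNone T) := by
    intro T
    ext i
    simp
  intro T hT hT'
  by_cases hn : none ∈ T
  · rw [isFace_extend_of_mem (by simp [hn]), eraseNone_map_union] at hT
    rw [isFace_extend_of_mem (by simp [hn]), he] at hT'
    obtain ⟨M, hM, hc, hf⟩ := h2 _ hT hT'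
    exact key T M hM hc hf
  · rw [isFace_extend_of_notMem (by simp [hn]), eraseNone_map_union] at hT
    rw [isFace_extend_of_notMem (by simp [hn]), he] at hT'
    obtain ⟨M, hM, hc, hf⟩ := h1 _ hT hT'
    exact key T M hM hc hf

theorem union_eq_insert_union_erase (F : Finset ι) {G : Finset ι} (hc : c ∈ G) :
    F ∪ G = insert c (F ∪ G.erase c) := by
  rw [← Finset.union_insert, Finset.insert_erase hc]

/-- If G meets the edge ab, one of its elements is absorbed by the larger face F ∪ {a, b}. Otherwise
sets without the new vector stay faces, and in sets with it a takes its place, at no cost in size.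
-/
theorem LexStep.linkNeighborly (hs : LexStep v y a b F) (ha : a ∉ F) (hb : b ∉ F)
    (hN : LinkNeighborly v F (k + 1))
    (hN' : LinkNeighborly (extend v y) ((insert a (insert b F)).map Function.Embedding.some) k) :
    LinkNeighborly (extend v y) (F.map Function.Embedding.some) (k + 1) := by
  rw [linkNeighborly_extend_iff] at hN' ⊢
  obtain ⟨hA, hB⟩ := hN'
  refine ⟨fun G hG => ?_, fun G hG => ?_⟩
  · by_cases haG : a ∈ G
    · refine (hA (G.erase a) ?_).mono (by grind)
      rw [Finset.card_erase_of_mem haG]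
      omega
    · exact hs.faceWithout _ Finset.subset_union_left (by grind) (hN G hG)
  · by_cases haG : a ∈ G
    · refine (hB (G.erase a) ?_).mono (by grind)
      rw [Finset.card_erase_add_one haG]
      omega
    by_cases hbG : b ∈ G
    · refine (hB (G.erase b) ?_).mono (by grind)
      rw [Finset.card_erase_add_one hbG]
      omega
    · refine hs.faceWith _ Finset.subset_union_left (by grind) (by grind) ?_
      rw [← Finset.union_insert]
      exact hN _ ((Finset.card_insert_le _ _).trans hG)

/-- For a nonface through the new vector y the cases are: a ∈ G and b ∉ G cannot occur when F ∪ G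
survives; if G misses both, or contains b while F ∪ G ∪ {a} is not an old face, an old nonface is
used with y in place of a; the other cases reduce to the link of F ∪ {a, b}, adding b to the nonface
found there. The second alternative in `h1` lets a nonface of F itself stand in where the link of
the edge has no small one. -/
theorem LexStep.linkMissing (hs : LexStep v y a b F) (ha : a ∉ F) (hb : b ∉ F)
    (hM : LinkMissing v F k)
    (h1 : ∀ G, ¬ FaceWithout v y (insert a (insert b F) ∪ G) →
      ∃ M ⊆ G, (M.card ≤ k ∧ ¬ FaceWithout v y (insert a (insert b F) ∪ M)) ∨
        (M.card ≤ k + 1 ∧ ¬ IsFace v (F ∪ M)))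
    (h2 : ∀ G, FaceWithout v y (insert a (insert b F) ∪ G) →
      ¬ FaceWith v y (insert a (insert b F) ∪ G) →
      ∃ M ⊆ G, M.card + 1 ≤ k ∧ ¬ FaceWith v y (insert a (insert b F) ∪ M)) :
    LinkMissing (extend v y) (F.map Function.Embedding.some) k := by
  have hsub : ∀ G : Finset ι, F ⊆ F ∪ G := fun G => Finset.subset_union_left
  have e : ∀ G : Finset ι, insert a (insert b F) ∪ G = insert a (insert b (F ∪ G)) := by simp
  rw [linkMissing_extend_iff]
  have hA : ∀ G : Finset ι, ¬ FaceWithout v y (F ∪ G) →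
        ∃ M ⊆ G, M.card ≤ k + 1 ∧ ¬ FaceWithout v y (F ∪ M) := by
    intro G hG
    by_cases haG : a ∈ G
    · obtain ⟨M, hMG, ⟨hc, hf⟩ | ⟨hc, hf⟩⟩ := h1 (G.erase a) fun h => hG (h.mono (by grind))
      · refine ⟨insert a M, by grind, (Finset.card_insert_le _ _).trans (by omega), fun h => hf ?_⟩
        rw [e]
        refine hs.faceWithout_both _ (hsub _) ?_
        rwa [← Finset.union_insert]
      · exact ⟨M, by grind, hc, fun h => hf h.isFace⟩
    · obtain ⟨M, hMG, hc, hf⟩ := hM G fun h => hG (hs.faceWithout _ (hsub _) (by grind) h)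
      exact ⟨M, hMG, hc, fun h => hf h.isFace⟩
  have hB : ∀ G G' : Finset ι, G' ⊆ G → b ∈ G → FaceWithout v y (insert a (insert b F) ∪ G') →
      ¬ FaceWith v y (insert a (insert b F) ∪ G') →
      ∃ M ⊆ G, (M.card ≤ k + 1 ∧ ¬ FaceWithout v y (F ∪ M)) ∨
          (M.card ≤ k ∧ ¬ FaceWith v y (F ∪ M)) := by
    intro G G' hGG hbG hG hG'
    obtain ⟨M, hMG, hc, hf⟩ := h2 G' hG hG'
    refine ⟨insert b M, by grind, Or.inr ⟨(Finset.card_insert_le _ _).trans hc, fun h => hf ?_⟩⟩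
    rw [e]
    refine hs.faceWith_both _ (hsub _) ?_ ?_
    · rwa [← Finset.union_insert]
    · rw [← e]
      exact hG.mono (Finset.union_subset_union_right hMG)
  refine ⟨hA, fun G hG => ?_⟩
  by_cases hAG : FaceWithout v y (F ∪ G)
  swap
  · obtain ⟨M, hMG, hM'⟩ := hA G hAG
    exact ⟨M, hMG, Or.inl hM'⟩
  -- Substituting y for a preserves the size: a face S with y forces S ∪ {a} to be an old face.
  have old : ¬ IsFace v (insert a (F ∪ G)) → ∃ M ⊆ G, (M.card ≤ k + 1 ∧ ¬ FaceWithout v y (F ∪ M)) ∨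
          (M.card ≤ k ∧ ¬ FaceWith v y (F ∪ M)) := by
    intro hK
    rw [← Finset.union_insert] at hK
    obtain ⟨Y, hY, hc, hf⟩ := hM _ hK
    by_cases haY : a ∈ Y
    · refine ⟨Y.erase a, by grind, Or.inr ⟨?_, fun h => hf ?_⟩⟩
      · rw [Finset.card_erase_of_mem haY]
        omega
      · have := hs.isFace _ (hsub _) h
        rwa [← Finset.union_insert, Finset.insert_erase haY] at this
    · exact ⟨Y, by grind, Or.inl ⟨hc, fun h => hf h.isFace⟩⟩
  by_cases haG : a ∈ G <;> by_cases hbG : b ∈ G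
  · have e2 : insert a (insert b F) ∪ G = F ∪ G := by grind
    exact hB G G subset_rfl hbG (by rwa [e2]) (by rwa [e2])
  · refine absurd ?_ hG
    have e2 := union_eq_insert_union_erase F haG
    rw [e2] at hAG ⊢
    exact hs.faceWith_left _ (hsub _) (by grind) (by grind) (hs.faceWithout_both _ (hsub _) hAG)
  · have e2 := union_eq_insert_union_erase F hbG
    by_cases hK : IsFace v (insert a (F ∪ G))
    · have hA' : FaceWithout v y (insert a (insert b F) ∪ G.erase b) := by
        by_contra hA'
        rw [e] at hA'
        rw [e2] at hG hK
        exact hG (hs.faceWith_right _ (hsub _) (by grind) (by grind) hK hA')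
      exact hB G _ (Finset.erase_subset _ _) hbG hA' fun h => hG (h.mono (by grind))
    · exact old hK
  · exact old fun hK => hG (hs.faceWith _ (hsub _) (by grind) (by grind) hK)

/-- Nonfaces of the link of an edge, in terms of the nonfaces of the complex. -/
theorem LinkMissing.insert_insert (hM : LinkMissing v F k) {G : Finset ι}
    (hG : ¬ IsFace v (insert a (insert b F) ∪ G)) :
    ∃ M ⊆ G, (M.card ≤ k ∧ ¬ IsFace v (insert a (insert b F) ∪ M)) ∨
        (M.card ≤ k + 1 ∧ ¬ IsFace v (F ∪ M)) := by
  obtain ⟨Y, hY, hc, hf⟩ := hM (insert a (insert b G)) fun h => hG (h.mono (by grind))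
  by_cases hYG : a ∈ Y ∨ b ∈ Y
  · refine ⟨(Y.erase a).erase b, by grind, Or.inl ⟨?_, fun h => hf (h.mono (by grind))⟩⟩
    rcases hYG with h | h
    · have h1 := Finset.card_erase_of_mem h
      have h2 := Finset.card_erase_le (s := Y.erase a) (a := b)
      omega
    · rw [Finset.erase_right_comm]
      have h1 := Finset.card_erase_of_mem h
      have h2 := Finset.card_erase_le (s := Y.erase b) (a := a)
      omega
  · exact ⟨Y, by grind, Or.inr ⟨hc, hf⟩⟩

/-- Induction along the flag: the statement for the larger face supplies what `LexStep.linkMissing`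
requires at the smaller one. In the base case the remaining chain is an interior vector, which lies
on no face, so the empty set is already a nonface with it. -/
theorem GoodFlag.extend (h : GoodFlag v F k L) (hy : LexChain v y L F) :
    GoodFlag (extend v y) (F.map Function.Embedding.some) k
      (L.map fun p => (some p.1, some p.2)) := by
  have emap : ∀ (F : Finset ι) (a b : ι), insert (some a) (insert (some b)
      (F.map Function.Embedding.some)) = (insert a (insert b F)).map Function.Embedding.some := by
    intro F a b
    simp
  induction h with
  | @base F a b hab ha hb hN hM hN' =>
    obtain ⟨hs, h1, h2⟩ := hy
    have hN0 : LinkNeighborly (VectorConfig.extend v y)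
        ((insert a (insert b F)).map Function.Embedding.some) 0 := by
      rw [linkNeighborly_extend_iff]
      exact ⟨fun G hG => h1 _ Finset.subset_union_left (hN' G hG), fun G hG => by omega⟩
    refine GoodFlag.base (by simpa using hab) (by simpa using ha) (by simpa using hb)
      (hs.linkNeighborly ha hb hN hN0) (hs.linkMissing ha hb hM (fun G hG => ?_) fun G _ _ => ?_)
      (by rwa [emap])
    · obtain ⟨M, hMG, hM'⟩ := hM.insert_insert fun h => hG (h1 _ Finset.subset_union_left h)
      exact ⟨M, hMG, hM'.imp_left fun h => ⟨h.1, fun h' => h.2 h'.isFace⟩⟩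
    · exact ⟨∅, Finset.empty_subset _, by simp, h2 _ Finset.subset_union_left⟩
  | @single F a b k L hab ha hb hN hM hG ih =>
    obtain ⟨hs, hy⟩ := hy
    have hG' := ih hy
    have hM' := hG'.linkMissing
    rw [linkMissing_extend_iff] at hM'
    refine GoodFlag.single (by simpa using hab) (by simpa using ha) (by simpa using hb)
      (hs.linkNeighborly ha hb hN hG'.linkNeighborly)
      (hs.linkMissing ha hb hM (fun G hG => ?_) fun G hG1 hG2 => ?_) (by rwa [emap])
    · obtain ⟨M, hMG, h⟩ := hM'.1 G hG
      exact ⟨M, hMG, Or.inl h⟩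
    · obtain ⟨M, hMG, ⟨hc, hf⟩ | ⟨hc, hf⟩⟩ := hM'.2 G hG2
      · exact absurd (hG1.mono (Finset.union_subset_union_right hMG)) hf
      · exact ⟨M, hMG, by omega, hf⟩
  | @double F a b c d k L hab ha hb hcd hc hd hN hM hN' hH hG ih =>
    obtain ⟨hs, hs', hy⟩ := hy
    have hG' := ih hy
    have hM' := hG'.linkMissing
    rw [linkMissing_extend_iff] at hM'
    obtain ⟨hA, hB⟩ := hM'
    have hN1 := hs'.linkNeighborly hc hd hN' hG'.linkNeighborly
    generalize hF' : insert a (insert b F) = F' at *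
    have hsub : ∀ G : Finset ι, F' ⊆ F' ∪ G := fun G => Finset.subset_union_left
    have e : ∀ G : Finset ι, insert c (insert d F') ∪ G = insert c (insert d (F' ∪ G)) := by simp
    -- Once c is present without the new vector, d can be added for free; hence a nonface over the
    -- far end of the flag needs only c over F'.
    have step : ∀ M : Finset ι, ¬ FaceWithout v y (insert c (insert d F') ∪ M) →
        ¬ FaceWithout v y (insert c (F' ∪ M)) := by
      intro M hf h
      refine hf ?_
      rw [e]
      exact hs'.faceWithout_both _ (hsub _) h
    have step2 : ∀ G G' : Finset ι, G' ⊆ G → d ∈ G →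
        FaceWithout v y (insert c (insert d F') ∪ G') →
        ¬ FaceWith v y (insert c (insert d F') ∪ G') →
        ∃ M ⊆ G, M.card + 1 ≤ k + 2 ∧ ¬ FaceWith v y (F' ∪ M) := by
      intro G G' hGG hdG h1 h2
      obtain ⟨M, hMG, ⟨hc, hf⟩ | ⟨hc, hf⟩⟩ := hB G' h2
      · exact absurd (h1.mono (Finset.union_subset_union_right hMG)) hf
      · refine ⟨insert d M, by grind, ?_, fun h => hf ?_⟩
        · have := Finset.card_insert_le d M
          omega
        · rw [e]
          refine hs'.faceWith_both _ (hsub _) ?_ ?_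
          · rwa [← Finset.union_insert]
          · rw [← e]
            exact h1.mono (Finset.union_subset_union_right hMG)
    -- The bound on nonfaces through c suffices here because the new vector, as a copy of c, meets
    -- old nonfaces only when adding c destroys a face.
    have old : ∀ G : Finset ι, IsFace v (F' ∪ G) → ¬ IsFace v (insert c (F' ∪ G)) →
        ∃ M ⊆ G, M.card + 1 ≤ k + 2 ∧ ¬ FaceWith v y (F' ∪ M) := by
      intro G h1 h2
      obtain ⟨M, hMG, hc, hf⟩ := hH G h1 h2
      exact ⟨M, hMG, by omega, fun h => hf (hs'.isFace _ (hsub _) h)⟩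
    -- The link of F' carries no bound on nonfaces avoiding c. Such a nonface comes from one of the
    -- link of F, which either loses an element to {a, b} or is itself small enough over F.
    have hR1 : ∀ G, ¬ FaceWithout v y (F' ∪ G) →
        ∃ M ⊆ G, (M.card ≤ k + 2 ∧ ¬ FaceWithout v y (F' ∪ M)) ∨
          (M.card ≤ k + 2 + 1 ∧ ¬ IsFace v (F ∪ M)) := by
      intro G hG
      by_cases hcG : c ∈ G
      · obtain ⟨M, hMG, hc', hf⟩ := hA G fun h => hG (h.mono (by grind))
        refine ⟨insert c M, by grind, Or.inl ⟨?_, fun h => step M hf ?_⟩⟩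
        · have := Finset.card_insert_le c M
          omega
        · rwa [← Finset.union_insert]
      · have hK : ¬ IsFace v (F' ∪ G) := fun h =>
          hG (hs'.faceWithout _ (hsub _) (by grind) h)
        rw [← hF'] at hK
        obtain ⟨M, hMG, hM'⟩ := hM.insert_insert hK
        rw [hF'] at hM'
        exact ⟨M, hMG, hM'.imp_left fun h => ⟨h.1, fun h' => h.2 h'.isFace⟩⟩
    have hR2 : ∀ G, FaceWithout v y (F' ∪ G) → ¬ FaceWith v y (F' ∪ G) →
        ∃ M ⊆ G, M.card + 1 ≤ k + 2 ∧ ¬ FaceWith v y (F' ∪ M) := by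
      intro G hAG hG
      by_cases hcG : c ∈ G <;> by_cases hdG : d ∈ G
      · have e2 : insert c (insert d F') ∪ G = F' ∪ G := by grind
        exact step2 G G subset_rfl hdG (by rwa [e2]) (by rwa [e2])
      · refine absurd ?_ hG
        have e2 := union_eq_insert_union_erase F' hcG
        rw [e2] at hAG ⊢
        exact hs'.faceWith_left _ (hsub _) (by grind) (by grind)
          (hs'.faceWithout_both _ (hsub _) hAG)
      · have e2 := union_eq_insert_union_erase F' hdG
        by_cases hK : IsFace v (insert c (F' ∪ G))
        · have hA' : FaceWithout v y (insert c (insert d F') ∪ G.erase d) := by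
            by_contra hA'
            rw [e] at hA'
            rw [e2] at hG hK
            exact hG (hs'.faceWith_right _ (hsub _) (by grind) (by grind) hK hA')
          exact step2 G _ (Finset.erase_subset _ _) hdG hA' fun h => hG (h.mono (by grind))
        · exact old G hAG.isFace hK
      · exact old G hAG.isFace fun hK => hG (hs'.faceWith _ (hsub _) (by grind) (by grind) hK)
    have hA1 : ∀ G, ¬ FaceWithout v y (insert c (insert d F') ∪ G) →
        ∃ M ⊆ G, M.card ≤ k + 1 ∧ ¬ FaceWithout v y (insert c (F' ∪ M)) := by
      intro G hG
      obtain ⟨M, hMG, hc', hf⟩ := hA G hG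
      exact ⟨M, hMG, hc', step M hf⟩
    -- The restricted bound at c must itself be inherited. If G is a face over F' with the new
    -- vector and F' ∪ G ∪ {c, d} survives without it, then c can be added too, so only the far link
    -- produces nonfaces.
    have hH' : LinkMissingAt (VectorConfig.extend v y) (F'.map Function.Embedding.some)
        (some c) k := by
      refine linkMissingAt_extend (fun G _ hG => hA1 G fun h => hG (h.mono (by grind)))
        fun G hBG hG => ?_
      by_cases hA' : FaceWithout v y (insert c (insert d F') ∪ G)
      · exfalso
        by_cases hcG : c ∈ G
        · exact hG (by rwa [Finset.insert_eq_of_mem (by grind)])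
        by_cases hdG : d ∈ G
        · have hd2 : insert d (F' ∪ G) = F' ∪ G := Finset.insert_eq_of_mem (by grind)
          refine hG ((hs'.faceWith_both (F' ∪ G) (hsub _) (by rwa [hd2]) ?_).mono (by grind))
          rwa [← e]
        · rw [e] at hA'
          exact hG (hs'.faceWith_left _ (hsub _) (by grind) (by grind) hA')
      · exact hA1 G hA'
    refine GoodFlag.double (by simpa using hab) (by simpa using ha) (by simpa using hb)
      (by simpa using hcd) ?_ ?_ (hs.linkNeighborly ha hb hN (by rwa [hF']))
      (hs.linkMissing ha hb hM (by rwa [hF']) (by rwa [hF'])) ?_ ?_ ?_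
    · rw [emap, hF']; simpa using hc
    · rw [emap, hF']; simpa using hd
    · rwa [emap, hF']
    · rwa [emap, hF']
    · rw [emap F a b, hF', emap]
      exact hG'

end Flags

/-- Configurations with a good flag exist with any larger number of vectors. -/
theorem exists_goodFlag_of_le {W : Type*} [NormedAddCommGroup W] [NormedSpace ℝ W]
    [FiniteDimensional ℝ W] {d k m n : ℕ} (hmn : m ≤ n)
    (h : ∃ (ι : Type) (_ : Fintype ι) (_ : DecidableEq ι) (v : ι → W →ₗ[ℝ] ℝ)
      (L : List (ι × ι)), Fintype.card ι = m ∧ GenPos v d ∧ GoodFlag v ∅ k L) :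
    ∃ (ι : Type) (_ : Fintype ι) (_ : DecidableEq ι) (v : ι → W →ₗ[ℝ] ℝ)
      (L : List (ι × ι)), Fintype.card ι = n ∧ GenPos v d ∧ GoodFlag v ∅ k L := by
  induction n, hmn using Nat.le_induction with
  | base => exact h
  | succ n _ ih =>
    obtain ⟨ι, _, _, v, L, hc, hv, hL⟩ := ih
    obtain ⟨y, hy, hchain⟩ := exists_lexChain hv L hL.ne
    refine ⟨Option ι, inferInstance, inferInstance, extend v y,
      L.map fun p => (some p.1, some p.2), by simp [hc], hy, ?_⟩
    simpa using hL.extend hchain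

end VectorConfig

/-! ### From vector configurations to polytopes -/

namespace VectorConfig

/-- The configuration of evaluations of the affine functionals `p ↦ c + ⟪w, p⟫` at points. -/
noncomputable def affineConfig {ι : Type*} {d : ℕ} (x : ι → EuclideanSpace ℝ (Fin d)) (i : ι) :
    ℝ × EuclideanSpace ℝ (Fin d) →ₗ[ℝ] ℝ :=
  LinearMap.coprod LinearMap.id (innerₗ _ (x i))

section Affine

variable {ι : Type*} {d : ℕ} {x : ι → EuclideanSpace ℝ (Fin d)}

theorem affineConfig_apply (i : ι) (h : ℝ × EuclideanSpace ℝ (Fin d)) :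
    affineConfig x i h = h.1 + inner ℝ h.2 (x i) := by
  simp [affineConfig, real_inner_comm]

/-- A vector configuration with a positive functional comes from a point configuration. -/
theorem exists_affineConfig {W : Type*} [NormedAddCommGroup W] [NormedSpace ℝ W]
    [FiniteDimensional ℝ W] [Fintype ι] {v : ι → W →ₗ[ℝ] ℝ} (hv : GenPos v d)
    (h0 : IsFace v ∅) : ∃ x : ι → EuclideanSpace ℝ (Fin d), GenPos (affineConfig x) d ∧
      ∀ S, IsFace (affineConfig x) S ↔ IsFace v S := by
  obtain ⟨f, -, hf⟩ := h0.exists_strict hv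
  have hf : ∀ i, 0 < v i f := fun i => hf i (by simp)
  have f0 : f ≠ 0 := by
    rintro rfl
    have : Nonempty ι := Fintype.card_pos_iff.1 ((Nat.zero_le _).trans_lt hv.lt_card)
    simpa using hf (Classical.arbitrary ι)
  obtain ⟨Q, hQ⟩ := Submodule.exists_isCompl (Submodule.span ℝ {f})
  have hQd : Module.finrank ℝ Q = d := by
    have := Submodule.finrank_add_eq_of_isCompl hQ
    rw [finrank_span_singleton f0, hv.finrank_eq] at this
    omega
  let e2 : EuclideanSpace ℝ (Fin d) ≃ₗ[ℝ] Q := LinearEquiv.ofFinrankEq _ _ (by simp [hQd])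
  let e : (ℝ × EuclideanSpace ℝ (Fin d)) ≃ₗ[ℝ] W :=
    ((LinearEquiv.toSpanNonzeroSingleton ℝ W f f0).prodCongr e2).trans
      (Submodule.prodEquivOfIsCompl _ _ hQ)
  have he : ∀ h, e h = h.1 • f + e2 h.2 := fun h => by
    simp [e, LinearEquiv.toSpanNonzeroSingleton_apply]
  -- Division by v i f > 0 makes every functional take the value 1 at f; its restriction to a
  -- complement of f is then the position of a point. Positive rescaling leaves the faces unchanged.
  let y : ∀ i : ι, EuclideanSpace ℝ (Fin d) →L[ℝ] ℝ := fun i =>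
    LinearMap.toContinuousLinearMap ((v i f)⁻¹ • (v i ∘ₗ Q.subtype ∘ₗ e2.toLinearMap))
  let x : ι → EuclideanSpace ℝ (Fin d) := fun i => (InnerProductSpace.toDual ℝ _).symm (y i)
  have hx : ∀ i h, v i (e h) = v i f * affineConfig x i h := by
    intro i h
    rw [affineConfig_apply, he, real_inner_comm, InnerProductSpace.toDual_symm_apply]
    have hy : y i h.2 = (v i f)⁻¹ * v i (e2 h.2) := rfl
    have := (hf i).ne'
    rw [hy, map_add, map_smul, smul_eq_mul]
    field_simp
  refine ⟨x, ⟨?_, hv.lt_card, fun h S hS hc => ?_⟩, fun S => ?_⟩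
  · rw [e.finrank_eq, hv.finrank_eq]
  · have := hv.eq_zero (e h) S (fun i hi => by rw [hx, hS i hi, mul_zero]) hc
    simpa using this
  · constructor
    · rintro ⟨h, h1, h2, h3⟩
      refine ⟨e h, by simpa using h1, fun i => ?_, fun i hi => ?_⟩
      · rw [hx]
        exact mul_nonneg (hf i).le (h2 i)
      · rw [hx, h3 i hi, mul_zero]
    · rintro ⟨h, h1, h2, h3⟩
      obtain ⟨h, rfl⟩ := e.surjective h
      refine ⟨h, by simpa using h1, fun i => ?_, fun i hi => ?_⟩
      · have := h2 i
        rw [hx] at this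
        exact nonneg_of_mul_nonneg_right this (hf i)
      · have := h3 i hi
        rw [hx] at this
        simpa [(hf i).ne'] using this

/-- The face of the polytope on which an affine functional vanishes. -/
def faceSet (x : ι → EuclideanSpace ℝ (Fin d)) (h : ℝ × EuclideanSpace ℝ (Fin d)) :
    Set (EuclideanSpace ℝ (Fin d)) :=
  {p ∈ convexHull ℝ (Set.range x) | h.1 + inner ℝ h.2 p = 0}

variable {h : ℝ × EuclideanSpace ℝ (Fin d)}

theorem nonneg_of_mem_convexHull (hn : ∀ i, 0 ≤ affineConfig x i h)
    {p : EuclideanSpace ℝ (Fin d)} (hp : p ∈ convexHull ℝ (Set.range x)) :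
    0 ≤ h.1 + inner ℝ h.2 p := by
  have hconv : Convex ℝ {p : EuclideanSpace ℝ (Fin d) | 0 ≤ h.1 + inner ℝ h.2 p} := by
    intro p hp q hq a b ha hb hab
    simp only [Set.mem_ofPred_eq, inner_add_right, inner_smul_right] at *
    have : h.1 + (a * inner ℝ h.2 p + b * inner ℝ h.2 q) =
        a * (h.1 + inner ℝ h.2 p) + b * (h.1 + inner ℝ h.2 q) := by
      linear_combination (-h.1) * hab
    rw [this]
    positivity
  refine convexHull_min ?_ hconv hp
  rintro _ ⟨i, rfl⟩
  simpa [affineConfig_apply] using hn i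

theorem mem_faceSet_iff (i : ι) : x i ∈ faceSet x h ↔ affineConfig x i h = 0 := by
  rw [affineConfig_apply]
  exact ⟨fun hi => hi.2, fun hi => ⟨subset_convexHull _ _ ⟨i, rfl⟩, hi⟩⟩

theorem isExposed_faceSet (hn : ∀ i, 0 ≤ affineConfig x i h) :
    IsExposed ℝ (convexHull ℝ (Set.range x)) (faceSet x h) := by
  rintro ⟨z, hz, hz0⟩
  refine ⟨-innerSL ℝ h.2, ?_⟩
  ext p
  constructor
  · rintro ⟨hp, hp0⟩
    refine ⟨hp, fun q hq => ?_⟩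
    have := nonneg_of_mem_convexHull hn hq
    simp only [neg_apply, innerSL_apply_apply]
    linarith
  · rintro ⟨hp, hmax⟩
    refine ⟨hp, le_antisymm ?_ (nonneg_of_mem_convexHull hn hp)⟩
    have := hmax z hz
    simp only [neg_apply, innerSL_apply_apply] at this
    linarith

/-- A convex combination at which a nonnegative affine functional vanishes gives positive weight
only to points where it vanishes. -/
theorem faceSet_eq_convexHull (hn : ∀ i, 0 ≤ affineConfig x i h) :
    faceSet x h = convexHull ℝ (x '' {i | affineConfig x i h = 0}) := by
  apply Set.Subset.antisymm
  · rintro p ⟨hp, hp0⟩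
    obtain ⟨κ, _, w, z, hw, hw1, hz, rfl⟩ := mem_convexHull_iff_exists_fintype.1 hp
    have hzn : ∀ j, 0 ≤ h.1 + inner ℝ h.2 (z j) := fun j =>
      nonneg_of_mem_convexHull hn (subset_convexHull _ _ (hz j))
    have hsum : ∑ j, w j * (h.1 + inner ℝ h.2 (z j)) = 0 := by
      rw [← hp0, inner_sum]
      simp only [mul_add, inner_smul_right, Finset.sum_add_distrib, ← Finset.sum_mul, hw1, one_mul]
    have hzero := (Finset.sum_eq_zero_iff_of_nonneg fun j _ => mul_nonneg (hw j) (hzn j)).1 hsum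
    have : ∑ j, w j • z j = ∑ j with w j ≠ 0, w j • z j := by
      rw [Finset.sum_filter]
      refine Finset.sum_congr rfl fun j _ => ?_
      by_cases hj : w j = 0 <;> simp [hj]
    rw [this]
    refine (convex_convexHull ℝ _).sum_mem (fun j _ => hw j) ?_ fun j hj => ?_
    · rw [Finset.sum_filter_ne_zero, hw1]
    · apply subset_convexHull
      obtain ⟨i, hi⟩ := hz j
      refine ⟨i, ?_, hi⟩
      have := hzero j (Finset.mem_univ _)
      rw [mul_eq_zero, or_iff_right (Finset.mem_filter.1 hj).2] at this
      rw [Set.mem_ofPred_eq, affineConfig_apply, hi, this]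
  · refine convexHull_min ?_ ?_
    · rintro _ ⟨i, hi, rfl⟩
      exact (mem_faceSet_iff i).2 hi
    · exact (isExposed_faceSet hn).convex (convex_convexHull ℝ _)

/-- If u is maximal on F at p, the affine functional ⟪u, p⟫ - ⟪u, ·⟫ is nonnegative and cuts out F;
were it the zero pair, F would be the whole polytope. -/
theorem exists_eq_faceSet [Nonempty ι] {F : Set (EuclideanSpace ℝ (Fin d))}
    (hF : ConvexPolytope.IsProperFace (convexHull ℝ (Set.range x)) F) (hne : F.Nonempty) :
    ∃ h, h ≠ 0 ∧ (∀ i, 0 ≤ affineConfig x i h) ∧ F = faceSet x h := by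
  obtain ⟨hexp, hP⟩ := hF
  obtain ⟨l, hl⟩ := hexp hne
  obtain ⟨u, rfl⟩ := (InnerProductSpace.toDual ℝ (EuclideanSpace ℝ (Fin d))).surjective l
  obtain ⟨p, hp⟩ := hne
  have hp' := hp
  rw [hl] at hp'
  obtain ⟨hpP, hmax⟩ := hp'
  simp only [InnerProductSpace.toDual_apply_apply] at hl hmax
  have hF : F = faceSet x (inner ℝ u p, -u) := by
    rw [hl]
    ext q
    simp only [faceSet, Set.mem_ofPred_eq, inner_neg_left]
    refine and_congr_right fun hq => ⟨fun h => ?_, fun h r hr => ?_⟩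
    · linarith [h p hpP, hmax q hq]
    · linarith [hmax r hr]
  refine ⟨_, ?_, fun i => ?_, hF⟩
  · intro h
    simp only [Prod.mk_eq_zero, neg_eq_zero] at h
    refine hP ?_
    rw [hF]
    ext q
    simp [faceSet, h.2]
  · rw [affineConfig_apply]
    have := hmax (x i) (subset_convexHull _ _ ⟨i, rfl⟩)
    simp only [inner_neg_left]
    linarith

variable [Fintype ι]

theorem faceSet_ne (hx : GenPos (affineConfig x) d) (h0 : h ≠ 0)
    (hn : ∀ i, 0 ≤ affineConfig x i h) : faceSet x h ≠ convexHull ℝ (Set.range x) := by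
  intro he
  obtain ⟨i, hi⟩ := hx.exists_pos h0 hn
  have : x i ∈ faceSet x h := by
    rw [he]
    exact subset_convexHull _ _ ⟨i, rfl⟩
  exact hi.ne' ((mem_faceSet_iff i).1 this)

theorem GenPos.injective (hx : GenPos (affineConfig x) d) (hd : 1 ≤ d) : Function.Injective x := by
  classical
  intro i j hij
  by_contra hne
  obtain ⟨g, hg⟩ := hx.exists_eval_eq (S := {i, j}) (by rw [Finset.card_pair hne]; omega)
    fun m => if m = i then 1 else 0
  have h1 := hg i (by simp)
  have h2 := hg j (by simp)
  rw [affineConfig_apply] at h1 h2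
  rw [hij, h2] at h1
  simp [Ne.symm hne] at h1

/-- Affine functionals equal to 1 at one vertex of the face and 0 at the others exist by general
position, and each reads off one coefficient of an affine dependence. -/
theorem isSimplex_faceSet (hx : GenPos (affineConfig x) d) (h0 : h ≠ 0)
    (hn : ∀ i, 0 ≤ affineConfig x i h) : ConvexPolytope.IsSimplex (faceSet x h) := by
  classical
  let Z : Finset ι := {i | affineConfig x i h = 0}
  have hZ : Z.card ≤ d := hx.card_le h0 fun i hi => (Finset.mem_filter.1 hi).2
  refine ⟨Z.image x, ?_, ?_⟩
  · rw [affineIndependent_iff]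
    intro s w hw hws e he
    obtain ⟨i, hi, hie⟩ := Finset.mem_image.1 e.2
    obtain ⟨g, hg⟩ := hx.exists_eval_eq (S := Z) (by omega) fun j => if x j = e then 1 else 0
    have hval : ∀ p : (Z.image x : Finset _), g.1 + inner ℝ g.2 (p : EuclideanSpace ℝ (Fin d)) =
        if (p : EuclideanSpace ℝ (Fin d)) = e then 1 else 0 := by
      intro p
      obtain ⟨j, hj, hjp⟩ := Finset.mem_image.1 p.2
      rw [← hjp, ← affineConfig_apply, hg j hj]
    have hsum : ∑ p ∈ s, w p * (g.1 + inner ℝ g.2 (p : EuclideanSpace ℝ (Fin d))) = 0 := by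
      have : inner ℝ g.2 (∑ p ∈ s, w p • (p : EuclideanSpace ℝ (Fin d))) = 0 := by
        rw [hws, inner_zero_right]
      rw [inner_sum] at this
      simp only [inner_smul_right] at this
      simp only [mul_add, Finset.sum_add_distrib, ← Finset.sum_mul, hw, this, zero_mul, add_zero]
    simp only [hval, ← Subtype.ext_iff] at hsum
    simpa [he] using hsum
  · rw [faceSet_eq_convexHull hn]
    simp [Z]

theorem IsFace.isExposed_singleton (hx : GenPos (affineConfig x) d) {i : ι}
    (hi : IsFace (affineConfig x) {i}) : x i ∈ (convexHull ℝ (Set.range x)).extremePoints ℝ := by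
  obtain ⟨h, h1, h2⟩ := hi.exists_strict hx
  have hn : ∀ j, 0 ≤ affineConfig x j h := fun j => by
    by_cases hj : j ∈ ({i} : Finset ι)
    · exact (h1 j hj).ge
    · exact (h2 j hj).le
  have hset : {j | affineConfig x j h = 0} = {i} := by
    ext j
    simp only [Set.mem_ofPred_eq, Set.mem_singleton_iff]
    refine ⟨fun hj => ?_, fun hj => h1 j (by simp [hj])⟩
    by_contra hne
    exact (h2 j (by simpa using hne)).ne' hj
  rw [← isExtreme_singleton]
  have := (isExposed_faceSet hn).isExtreme
  rwa [faceSet_eq_convexHull hn, hset, Set.image_singleton, convexHull_singleton] at this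

theorem vertices_convexHull (hx : GenPos (affineConfig x) d)
    (hi : ∀ i, IsFace (affineConfig x) {i}) :
    ConvexPolytope.vertices (convexHull ℝ (Set.range x)) = Set.range x := by
  apply Set.Subset.antisymm extremePoints_convexHull_subset
  rintro _ ⟨i, rfl⟩
  exact (hi i).isExposed_singleton hx

theorem vertices_faceSet (hx : GenPos (affineConfig x) d)
    (hi : ∀ i, IsFace (affineConfig x) {i}) (hn : ∀ i, 0 ≤ affineConfig x i h) :
    ConvexPolytope.vertices (faceSet x h) = x '' {i | affineConfig x i h = 0} := by
  rw [ConvexPolytope.vertices, (isExposed_faceSet hn).isExtreme.extremePoints_eq]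
  change faceSet x h ∩ ConvexPolytope.vertices _ = _
  rw [vertices_convexHull hx hi]
  ext p
  constructor
  · rintro ⟨hp, i, rfl⟩
    exact ⟨i, (mem_faceSet_iff i).1 hp, rfl⟩
  · rintro ⟨i, hi, rfl⟩
    exact ⟨(mem_faceSet_iff i).2 hi, i, rfl⟩

/-- A proper face has as vertices the full zero set of its functional; conversely strict witnesses
realize each face of the configuration exactly. -/
theorem mem_boundaryComplex_iff [DecidableEq (EuclideanSpace ℝ (Fin d))]
    (hx : GenPos (affineConfig x) d) (h0 : IsFace (affineConfig x) ∅)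
    (hi : ∀ i, IsFace (affineConfig x) {i}) (s : Finset (EuclideanSpace ℝ (Fin d))) :
    s ∈ ConvexPolytope.boundaryComplex (convexHull ℝ (Set.range x)) ↔
      ∃ Z : Finset ι, IsFace (affineConfig x) Z ∧ s = Z.image x := by
  have : Nonempty ι := Fintype.card_pos_iff.1 ((Nat.zero_le _).trans_lt hx.lt_card)
  constructor
  · rintro ⟨F, hF, hs⟩
    rcases F.eq_empty_or_nonempty with rfl | hne
    · refine ⟨∅, h0, ?_⟩
      rw [← Finset.coe_inj, hs]
      simp [ConvexPolytope.vertices]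
    · obtain ⟨h, hh, hn, rfl⟩ := exists_eq_faceSet hF hne
      refine ⟨Finset.univ.filter fun i => affineConfig x i h = 0, ⟨h, hh, hn, fun i hi => (Finset.mem_filter.1 hi).2⟩, ?_⟩
      rw [← Finset.coe_inj, hs, vertices_faceSet hx hi hn]
      simp
  · rintro ⟨Z, hZ, rfl⟩
    rcases Z.eq_empty_or_nonempty with rfl | ⟨z, hz⟩
    -- The empty set is exposed vacuously, since `IsExposed` makes a demand only on nonempty sets.
    · refine ⟨∅, ⟨fun h => absurd h (by simp), ?_⟩, by simp [ConvexPolytope.vertices]⟩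
      have hne : (convexHull ℝ (Set.range x)).Nonempty := (Set.range_nonempty x).convexHull
      exact hne.ne_empty.symm
    · have hcard : Z.card ≤ d := by
        obtain ⟨f, f0, -, f2⟩ := hZ
        exact hx.card_le f0 f2
      obtain ⟨j, hj⟩ : ∃ j, j ∉ Z := by
        by_contra! hall
        have := hx.lt_card
        rw [← Finset.card_univ, ← Finset.eq_univ_of_forall hall] at this
        omega
      obtain ⟨h, h1, h2⟩ := hZ.exists_strict hx
      have hh : h ≠ 0 := by
        rintro rfl
        simpa using h2 j hj
      have hn : ∀ i, 0 ≤ affineConfig x i h := fun i => by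
        by_cases hi : i ∈ Z
        · exact (h1 i hi).ge
        · exact (h2 i hi).le
      refine ⟨faceSet x h, ⟨isExposed_faceSet hn, faceSet_ne hx hh hn⟩, ?_⟩
      rw [vertices_faceSet hx hi hn, Finset.coe_image]
      congr 1
      ext i
      refine ⟨fun hi => h1 i hi, fun hi => ?_⟩
      by_contra hne
      exact (h2 i hne).ne' hi

/-- A vector orthogonal to all differences of vertices gives an affine functional vanishing at every
point, which general position forces to be zero. -/
theorem dim_convexHull (hx : GenPos (affineConfig x) d) :
    ConvexPolytope.dim (convexHull ℝ (Set.range x)) = d := by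
  have : Nonempty ι := Fintype.card_pos_iff.1 ((Nat.zero_le _).trans_lt hx.lt_card)
  let i₀ := Classical.arbitrary ι
  have htop : vectorSpan ℝ (convexHull ℝ (Set.range x)) = ⊤ := by
    rw [← Submodule.orthogonal_eq_bot_iff, Submodule.eq_bot_iff]
    intro u hu
    have key : ((-inner ℝ u (x i₀), u) : ℝ × EuclideanSpace ℝ (Fin d)) = 0 := by
      refine hx.eq_zero _ Finset.univ (fun i _ => ?_) (by simpa using hx.lt_card)
      rw [affineConfig_apply]
      have h1 : x i -ᵥ x i₀ ∈ vectorSpan ℝ (convexHull ℝ (Set.range x)) :=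
        vsub_mem_vectorSpan ℝ (subset_convexHull _ _ ⟨i, rfl⟩) (subset_convexHull _ _ ⟨i₀, rfl⟩)
      have h2 := (Submodule.mem_orthogonal' _ _).1 hu _ h1
      rw [vsub_eq_sub, inner_sub_right] at h2
      linarith
    exact (Prod.mk_eq_zero.1 key).2
  rw [ConvexPolytope.dim, htop, finrank_top, finrank_euclideanSpace_fin]

end Affine

/-- A configuration with a neighborly complex all of whose minimal nonfaces are small yields a
neighborly polytope. -/
theorem exists_polytope {W ι : Type*} [NormedAddCommGroup W] [NormedSpace ℝ W]
    [FiniteDimensional ℝ W] [Fintype ι] [DecidableEq ι] {v : ι → W →ₗ[ℝ] ℝ} {k : ℕ} (hk : 1 ≤ k)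
    (hv : GenPos v (2 * k + 1)) (hN : LinkNeighborly v ∅ k) (hM : LinkMissing v ∅ k) :
    ∃ P : Set (EuclideanSpace ℝ (Fin (2 * k + 1))),
      ConvexPolytope.IsNeighborly P ∧
      ConvexPolytope.dim P = 2 * k + 1 ∧
      (ConvexPolytope.vertices P).ncard = Fintype.card ι ∧
      (∀ M : Finset (EuclideanSpace ℝ (Fin (2 * k + 1))),
        ConvexPolytope.IsMissingFace P M → M.card = k + 1) ∧
      ConvexPolytope.missingFaceCount P (k + 1) = 0 := by
  classical
  have hN' : ∀ G : Finset ι, G.card ≤ k → IsFace v G := fun G hG => by simpa using hN G hG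
  obtain ⟨x, hx, hface⟩ := exists_affineConfig hv (hN' ∅ (by simp))
  have hE : ∀ G : Finset ι, G.card ≤ k → IsFace (affineConfig x) G := fun G hG =>
    (hface G).2 (hN' G hG)
  have h0 := hE ∅ (by simp)
  have h1 : ∀ i, IsFace (affineConfig x) {i} := fun i => hE {i} (by simpa using hk)
  have hinj := hx.injective (by omega)
  have : Nonempty ι := Fintype.card_pos_iff.1 ((Nat.zero_le _).trans_lt hx.lt_card)
  have hcomplex := mem_boundaryComplex_iff hx h0 h1
  have hcount : ∀ j ≤ k, ConvexPolytope.faceCount (convexHull ℝ (Set.range x)) j =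
      (Fintype.card ι).choose j := by
    intro j hj
    have : {s : Finset (EuclideanSpace ℝ (Fin (2 * k + 1))) |
        s ∈ ConvexPolytope.boundaryComplex (convexHull ℝ (Set.range x)) ∧ s.card = j} =
        ((Finset.univ.powersetCard j).image (Finset.image x) : Finset _) := by
      ext s
      simp only [Set.mem_ofPred_eq, hcomplex, Finset.coe_image, Set.mem_image, Finset.mem_coe,
        Finset.mem_powersetCard, Finset.subset_univ, true_and]
      constructor
      · rintro ⟨⟨Z, hZ, rfl⟩, hc⟩
        exact ⟨Z, by rwa [Finset.card_image_of_injective _ hinj] at hc, rfl⟩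
      · rintro ⟨Z, hZ, rfl⟩
        exact ⟨⟨Z, hE Z (by omega), rfl⟩, by rw [Finset.card_image_of_injective _ hinj, hZ]⟩
    rw [ConvexPolytope.faceCount, this, Set.ncard_coe_finset,
      Finset.card_image_of_injective _ (Finset.image_injective hinj), Finset.card_powersetCard,
      Finset.card_univ]
  have hmissing : ∀ M : Finset (EuclideanSpace ℝ (Fin (2 * k + 1))),
      ConvexPolytope.IsMissingFace (convexHull ℝ (Set.range x)) M → M.card = k + 1 := by
    rintro M ⟨hMv, hMn, hMs⟩
    rw [vertices_convexHull hx h1] at hMv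
    obtain ⟨T, rfl⟩ : ∃ T : Finset ι, T.image x = M := by
      refine ⟨Finset.univ.filter fun i => x i ∈ M, ?_⟩
      ext p
      simp only [Finset.mem_image, Finset.mem_filter, Finset.mem_univ, true_and]
      constructor
      · rintro ⟨i, hi, rfl⟩
        exact hi
      · intro hp
        obtain ⟨i, rfl⟩ := hMv hp
        exact ⟨i, hp, rfl⟩
    have hiff : ∀ Z : Finset ι, Z.image x ∈
        ConvexPolytope.boundaryComplex (convexHull ℝ (Set.range x)) ↔ IsFace v Z := by
      intro Z
      rw [hcomplex, ← hface]
      constructor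
      · rintro ⟨Z', hZ', he⟩
        rwa [Finset.image_injective hinj he]
      · exact fun h => ⟨Z, h, rfl⟩
    rw [hiff] at hMn
    rw [Finset.card_image_of_injective _ hinj]
    refine le_antisymm ?_ ?_
    -- A small nonface inside a minimal nonface must be all of it, giving the upper bound;
    -- neighborliness gives the lower one.
    · obtain ⟨M, hMT, hc, hf⟩ := hM T (by simpa using hMn)
      rcases hMT.eq_or_ssubset with rfl | hss
      · exact hc
      · refine absurd ((hiff M).1 (hMs _ ?_)) (by simpa using hf)
        exact (Finset.image_ssubset_image hinj).2 hss
    · by_contra! hlt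
      exact hMn (hN' T (by omega))
  refine ⟨convexHull ℝ (Set.range x), ⟨⟨Finset.univ.image x, by simp⟩, fun F hF => ?_, ?_⟩,
    dim_convexHull hx, ?_, hmissing, ?_⟩
  · rcases F.eq_empty_or_nonempty with rfl | hne
    · exact ⟨∅, by
        have : IsEmpty ((∅ : Finset (EuclideanSpace ℝ (Fin (2 * k + 1)))) : Type) :=
          ⟨fun p => Finset.notMem_empty _ p.2⟩
        exact affineIndependent_of_subsingleton ℝ _, by simp⟩
    · obtain ⟨h, hh, hn, rfl⟩ := exists_eq_faceSet hF hne
      exact isSimplex_faceSet hx hh hn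
  · rw [ConvexPolytope.IsNeighborlyOfOrder, dim_convexHull hx, hcount 1 hk,
      show (2 * k + 1) / 2 = k by omega, hcount k le_rfl, Nat.choose_one_right]
  · rw [vertices_convexHull hx h1, ← Set.image_univ, Set.ncard_image_of_injective _ hinj,
      Set.ncard_univ, Nat.card_eq_fintype_card]
  · have : {M | ConvexPolytope.IsMissingFace (convexHull ℝ (Set.range x)) M ∧
        M.card = k + 1 + 1} = ∅ := by
      refine Set.eq_empty_iff_forall_notMem.2 ?_
      rintro M ⟨hM1, hM2⟩
      have := hmissing M hM1
      omega
    rw [ConvexPolytope.missingFaceCount, this, Set.ncard_empty]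

end VectorConfig

/-! ### Gale duality -/

namespace VectorConfig

section Gale

variable {ι V : Type*} [Fintype ι] [AddCommGroup V] [Module ℝ V]

/-- The space of linear dependences of a family of vectors. -/
abbrev dependences (w : ι → V) : Submodule ℝ (ι → ℝ) :=
  LinearMap.ker (Fintype.linearCombination ℝ w)

/-- The coordinate functionals on the space of linear dependences: the Gale dual of `w`. -/
def galeDual (w : ι → V) (i : ι) : dependences w →ₗ[ℝ] ℝ :=
  LinearMap.proj i ∘ₗ (dependences w).subtype

theorem mem_dependences {w : ι → V} {h : ι → ℝ} : h ∈ dependences w ↔ ∑ i, h i • w i = 0 := by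
  rw [LinearMap.mem_ker, Fintype.linearCombination_apply]

theorem isFace_galeDual {w : ι → V} {S : Finset ι} {h : ι → ℝ} (h0 : h ≠ 0) (hpos : ∀ i, 0 ≤ h i)
    (hw : ∑ i, h i • w i = 0) (hS : ∀ i ∈ S, h i = 0) : IsFace (galeDual w) S :=
  ⟨⟨h, mem_dependences.2 hw⟩, fun e => h0 (congrArg Subtype.val e), hpos, hS⟩

/-- The easy half of Gordan's alternative: applying u to a nonnegative dependence supported off S
gives a vanishing sum of nonnegative terms, so every coefficient is zero. -/
theorem not_isFace_galeDual {w : ι → V} {S : Finset ι} (u : V →ₗ[ℝ] ℝ)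
    (hu : ∀ i, i ∉ S → 0 < u (w i)) : ¬IsFace (galeDual w) S := by
  rintro ⟨⟨h, hw⟩, h0, hpos, hS⟩
  refine h0 (Subtype.ext (funext fun i => ?_))
  have h1 : ∑ i, h i * u (w i) = 0 := by
    have := congrArg u (mem_dependences.1 hw)
    simpa [map_sum] using this
  have h2 : ∀ i ∈ Finset.univ, 0 ≤ h i * u (w i) := by
    intro i _
    by_cases hi : i ∈ S
    · rw [show h i = 0 from hS i hi, zero_mul]
    · exact mul_nonneg (hpos i) (hu i hi).le
  have h3 := (Finset.sum_eq_zero_iff_of_nonneg h2).1 h1 i (Finset.mem_univ i)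
  by_cases hi : i ∈ S
  · exact hS i hi
  · exact (mul_eq_zero.1 h3).resolve_right (hu i hi).ne'

/-- A dependence vanishing at more than d indices is supported on at most dim V of them, where the
vectors are independent. -/
theorem genPos_galeDual [FiniteDimensional ℝ V] [DecidableEq ι] {w : ι → V} {d : ℕ}
    (hcard : Fintype.card ι = d + 1 + Module.finrank ℝ V)
    (hw : ∀ S : Finset ι, S.card = Module.finrank ℝ V → ∀ h : ι → ℝ, (∀ i, i ∉ S → h i = 0) →
      ∑ i, h i • w i = 0 → h = 0) : GenPos (galeDual w) d := by
  have key : ∀ (h : dependences w) (S : Finset ι), (∀ i ∈ S, galeDual w i h = 0) → d < S.card →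
      h = 0 := by
    rintro ⟨h, hh⟩ S hS hd
    have hc : Sᶜ.card ≤ Module.finrank ℝ V := by rw [Finset.card_compl]; omega
    obtain ⟨T, hST, hT⟩ := Finset.exists_superset_card_eq hc (by omega)
    refine Subtype.ext (hw T hT h (fun i hi => ?_) (mem_dependences.1 hh))
    by_contra h'
    exact hi (hST (Finset.mem_compl.2 fun hi' => h' (hS i hi')))
  -- The dimension is at most d + 1 because d + 1 coordinates determine a dependence, and at least d
  -- + 1 by rank-nullity.
  refine ⟨le_antisymm ?_ ?_, by omega, key⟩
  · obtain ⟨S, -, hS⟩ := Finset.exists_subset_card_eq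
      (show d + 1 ≤ (Finset.univ : Finset ι).card by rw [Finset.card_univ]; omega)
    have hinj : Function.Injective (LinearMap.pi fun i : S => galeDual w i) := by
      rw [← LinearMap.ker_eq_bot, LinearMap.ker_eq_bot']
      intro h h0
      exact key h S (fun i hi => congrFun h0 ⟨i, hi⟩) (by omega)
    have := LinearMap.finrank_le_finrank_of_injective hinj
    simpa [hS] using this
  · have h1 := LinearMap.finrank_range_add_finrank_ker (Fintype.linearCombination ℝ w)
    have h2 := Submodule.finrank_le (LinearMap.range (Fintype.linearCombination ℝ w))
    rw [Module.finrank_fintype_fun_eq_card] at h1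
    change d + 1 ≤ Module.finrank ℝ (LinearMap.ker _)
    omega

end Gale

end VectorConfig

/-! ### The starting configuration for k = 2 -/

namespace VectorConfig

/-- Nine integral vectors in dimension three, the Gale dual of a neighborly `5`-polytope. -/
def nineVectors : Fin 9 → ℤ × ℤ × ℤ :=
  ![(1, -3, -1), (2, -1, 3), (-3, 2, 0), (4, 3, -4), (1, 2, 0), (-4, -2, -1), (1, -2, 1),
    (-1, 3, 3), (-2, 1, -4)]

/-- Positive dependences of `nineVectors`; their zero sets are facets. -/
def nineDependences : List (Fin 9 → ℤ) :=
  [![11, 9, 15, 4, 0, 0, 0, 0, 0], ![6, 2, 5, 0, 5, 0, 0, 0, 0], ![1, 27, 5, 0, 0, 0, 0, 0, 20],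
    ![13, 11, 0, 0, 45, 20, 0, 0, 0], ![1, 2, 0, 0, 0, 0, 0, 1, 2],
    ![1, 0, 30, 11, 0, 0, 45, 0, 0], ![79, 0, 30, 14, 0, 0, 0, 45, 0],
    ![8, 0, 9, 0, 11, 0, 8, 0, 0], ![12, 0, 5, 0, 7, 0, 0, 4, 0],
    ![83, 0, 0, 28, 0, 30, 0, 75, 0], ![11, 0, 0, 1, 0, 0, 0, 9, 3],
    ![2, 0, 0, 0, 23, 9, 11, 0, 0], ![23, 0, 0, 0, 28, 10, 0, 11, 0],
    ![7, 0, 0, 0, 2, 0, 0, 5, 2], ![0, 73, 30, 41, 0, 55, 0, 0, 0],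
    ![0, 55, 8, 0, 0, 1, 0, 0, 41], ![0, 17, 3, 0, 0, 0, 1, 0, 13],
    ![0, 29, 0, 13, 30, 35, 0, 0, 0], ![0, 83, 0, 61, 0, 95, 0, 30, 0],
    ![0, 19, 0, 0, 8, 5, 0, 0, 13], ![0, 75, 0, 0, 0, 5, 0, 8, 61],
    ![0, 10, 0, 0, 0, 0, 5, 3, 11], ![0, 0, 47, 18, 0, 1, 73, 0, 0],
    ![0, 0, 46, 17, 0, 0, 72, 0, 1], ![0, 0, 11, 0, 17, 0, 32, 0, 8],
    ![0, 0, 0, 2, 47, 21, 29, 0, 0], ![0, 0, 0, 43, 0, 52, 83, 47, 0],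
    ![0, 0, 0, 5, 0, 0, 55, 23, 26], ![0, 0, 0, 0, 29, 11, 19, 0, 2],
    ![0, 0, 0, 0, 10, 0, 35, 11, 17]]

/-- Minimal nonfaces, with functionals that are positive on the complementary vectors. -/
def nineNonfaces : List (List (Fin 9) × ℤ × ℤ × ℤ) :=
  [([0, 1, 6], -1, 1, -1), ([0, 3, 8], -5, 3, 12), ([0, 5, 6], 15, 23, -2),
    ([0, 5, 8], 15, 23, 32), ([1, 3, 4], -4, -2, 1), ([1, 6, 7], 0, 1, -4),
    ([2, 4, 7], 3, -5, -3), ([2, 5, 7], 3, -1, -2), ([2, 5, 8], 2, 0, 1), ([3, 4, 8], -1, -1, 1)]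

/-- Whether some dependence in `nineDependences` vanishes wherever `b` is true. -/
def nineFaceTest (b : Fin 9 → Bool) : Bool :=
  nineDependences.any fun h => (List.finRange 9).all fun i => !b i || h i == 0

theorem nineVectors_det_ne_zero : ∀ a b c : Fin 9, a ≠ b → a ≠ c → b ≠ c →
    (nineVectors a).1 * ((nineVectors b).2.1 * (nineVectors c).2.2 -
      (nineVectors b).2.2 * (nineVectors c).2.1) -
    (nineVectors a).2.1 * ((nineVectors b).1 * (nineVectors c).2.2 -
      (nineVectors b).2.2 * (nineVectors c).1) +
    (nineVectors a).2.2 * ((nineVectors b).1 * (nineVectors c).2.1 -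
      (nineVectors b).2.1 * (nineVectors c).1) ≠ 0 := by
  decide +kernel

theorem nineDependences_spec : ∀ h ∈ nineDependences, h ≠ 0 ∧ (∀ i, 0 ≤ h i) ∧
    ∑ i, h i * (nineVectors i).1 = 0 ∧ ∑ i, h i * (nineVectors i).2.1 = 0 ∧
    ∑ i, h i * (nineVectors i).2.2 = 0 := by
  decide +kernel

theorem nineNonfaces_spec : ∀ c ∈ nineNonfaces, c.1.toFinset.card = 3 ∧ ∀ i, i ∉ c.1 →
    0 < c.2.1 * (nineVectors i).1 + c.2.2.1 * (nineVectors i).2.1 +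
      c.2.2.2 * (nineVectors i).2.2 := by
  decide +kernel

theorem nineFaceTest_eq_true {S : Finset (Fin 9)} (hS : nineFaceTest (fun i => decide (i ∈ S))) :
    ∃ h ∈ nineDependences, ∀ i ∈ S, h i = 0 := by
  simpa [nineFaceTest, imp_iff_not_or] using hS

theorem fin_nine_fun_eq {α : Type*} (f : Fin 9 → α) :
    f = ![f 0, f 1, f 2, f 3, f 4, f 5, f 6, f 7, f 8] := by
  funext i
  fin_cases i <;> rfl

/-- Exhaustion over all 512 subsets: each lies in the zero set of a listed dependence or contains a
listed triple, so the two lists of certificates are complete. -/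
theorem nine_face_or_nonface (S : Finset (Fin 9)) :
    (∃ h ∈ nineDependences, ∀ i ∈ S, h i = 0) ∨ ∃ c ∈ nineNonfaces, c.1.toFinset ⊆ S := by
  have key : ∀ a b c d e f g h i : Bool,
      (nineNonfaces.any fun s => s.1.all ![a, b, c, d, e, f, g, h, i]) ||
        nineFaceTest ![a, b, c, d, e, f, g, h, i] := by
    decide +kernel
  have hS := key (decide (0 ∈ S)) (decide (1 ∈ S)) (decide (2 ∈ S)) (decide (3 ∈ S))
    (decide (4 ∈ S)) (decide (5 ∈ S)) (decide (6 ∈ S)) (decide (7 ∈ S)) (decide (8 ∈ S))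
  rw [← fin_nine_fun_eq fun i => decide (i ∈ S), Bool.or_eq_true] at hS
  rcases hS with hS | hS
  · obtain ⟨c, hc, hcS⟩ := List.any_eq_true.1 hS
    exact Or.inr ⟨c, hc, fun i hi =>
      of_decide_eq_true (List.all_eq_true.1 hcS i (List.mem_toFinset.1 hi))⟩
  · exact Or.inl (nineFaceTest_eq_true hS)

theorem nine_link_face_or_nonface (S : Finset (Fin 9)) :
    (∃ h ∈ nineDependences, ∀ i ∈ {7, 8} ∪ S, h i = 0) ∨
      ∃ M : Finset (Fin 9), M ⊆ S ∧ M.card = 2 ∧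
        ∃ c ∈ nineNonfaces, c.1.toFinset ⊆ {7, 8} ∪ M := by
  -- Membership of 7 and 8 in S is immaterial in the link of {7, 8}, so only seven truth values vary
  -- and the listed pairs avoid both.
  have key : ∀ a b c d e f g : Bool,
      ([[0, 3], [0, 5], [1, 6], [2, 4], [2, 5], [3, 4]].any fun s : List (Fin 9) =>
        s.all ![a, b, c, d, e, f, g, false, false]) ||
        nineFaceTest ![a, b, c, d, e, f, g, true, true] := by
    decide +kernel
  have pairs : ∀ s ∈ [[0, 3], [0, 5], [1, 6], [2, 4], [2, 5], ([3, 4] : List (Fin 9))],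
      s.toFinset.card = 2 ∧
        ∃ c ∈ nineNonfaces, c.1.toFinset ⊆ {7, 8} ∪ s.toFinset := by
    decide +kernel
  have hS := key (decide (0 ∈ S)) (decide (1 ∈ S)) (decide (2 ∈ S)) (decide (3 ∈ S))
    (decide (4 ∈ S)) (decide (5 ∈ S)) (decide (6 ∈ S))
  rw [Bool.or_eq_true] at hS
  rcases hS with hS | hS
  · obtain ⟨s, hs, hsS⟩ := List.any_eq_true.1 hS
    obtain ⟨hcard, hc⟩ := pairs s hs
    refine Or.inr ⟨s.toFinset, fun i hi => ?_, hcard, hc⟩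
    have := List.all_eq_true.1 hsS i (List.mem_toFinset.1 hi)
    fin_cases i <;> first | exact of_decide_eq_true this | exact absurd this Bool.false_ne_true
  · refine Or.inl (nineFaceTest_eq_true ?_)
    rw [fin_nine_fun_eq fun i => decide (i ∈ {7, 8} ∪ S)]
    simpa using hS

/-- The Gale dual of `nineVectors`. -/
noncomputable def nineConfig : Fin 9 → dependences
    (fun i : Fin 9 => (((nineVectors i).1 : ℝ), ((nineVectors i).2.1 : ℝ),
      ((nineVectors i).2.2 : ℝ))) →ₗ[ℝ] ℝ :=
  galeDual _

theorem genPos_nineConfig : GenPos nineConfig 5 := by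
  refine genPos_galeDual (by simp) ?_
  intro S hS h h0 hsum
  obtain ⟨a, b, c, hab, hac, hbc, rfl⟩ := Finset.card_eq_three.1 (hS.trans (by simp : _ = 3))
  rw [← Finset.sum_subset (Finset.subset_univ {a, b, c})
    (fun i _ hi => by rw [h0 i hi, zero_smul]), Finset.sum_insert (by simp [hab, hac]),
    Finset.sum_insert (by simpa using hbc), Finset.sum_singleton] at hsum
  have hD := nineVectors_det_ne_zero a b c hab hac hbc
  simp only [Prod.smul_mk, Prod.mk_add_mk, Prod.mk_eq_zero, smul_eq_mul] at hsum
  obtain ⟨e1, e2, e3⟩ := hsum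
  generalize nineVectors a = A at *
  generalize nineVectors b = B at *
  generalize nineVectors c = C at *
  have hD' := (Int.cast_ne_zero (α := ℝ)).2 hD
  push_cast at hD'
  have ha : h a = 0 := by
    refine (mul_eq_zero.1 ?_).resolve_right hD'
    linear_combination (B.2.1 * C.2.2 - B.2.2 * C.2.1 : ℝ) * e1 -
      (B.1 * C.2.2 - B.2.2 * C.1 : ℝ) * e2 + (B.1 * C.2.1 - B.2.1 * C.1 : ℝ) * e3
  have hb : h b = 0 := by
    refine (mul_eq_zero.1 ?_).resolve_right hD'
    linear_combination -(A.2.1 * C.2.2 - A.2.2 * C.2.1 : ℝ) * e1 +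
      (A.1 * C.2.2 - A.2.2 * C.1 : ℝ) * e2 - (A.1 * C.2.1 - A.2.1 * C.1 : ℝ) * e3
  have hc : h c = 0 := by
    refine (mul_eq_zero.1 ?_).resolve_right hD'
    linear_combination (A.2.1 * B.2.2 - A.2.2 * B.2.1 : ℝ) * e1 -
      (A.1 * B.2.2 - A.2.2 * B.1 : ℝ) * e2 + (A.1 * B.2.1 - A.2.1 * B.1 : ℝ) * e3
  funext i
  by_cases hi : i ∈ ({a, b, c} : Finset (Fin 9))
  · simp only [Finset.mem_insert, Finset.mem_singleton] at hi
    rcases hi with rfl | rfl | rfl <;> assumption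
  · exact h0 i hi

theorem isFace_nineConfig {S : Finset (Fin 9)} (hS : ∃ h ∈ nineDependences, ∀ i ∈ S, h i = 0) :
    IsFace nineConfig S := by
  obtain ⟨h, hh, hS⟩ := hS
  obtain ⟨h0, hpos, e1, e2, e3⟩ := nineDependences_spec h hh
  refine isFace_galeDual (h := fun i => (h i : ℝ)) ?_ (fun i => Int.cast_nonneg (hpos i)) ?_
    (fun i hi => by rw [hS i hi, Int.cast_zero])
  · exact fun e => h0 (funext fun i => by simpa using congrFun e i)
  · refine Prod.ext ?_ (Prod.ext ?_ ?_)
    · simpa [Prod.fst_sum] using congrArg (Int.cast : ℤ → ℝ) e1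
    · simpa [Prod.fst_sum, Prod.snd_sum] using congrArg (Int.cast : ℤ → ℝ) e2
    · simpa [Prod.fst_sum, Prod.snd_sum] using congrArg (Int.cast : ℤ → ℝ) e3

theorem not_isFace_nineConfig {S : Finset (Fin 9)} (hS : ∃ c ∈ nineNonfaces, c.1.toFinset ⊆ S) :
    ¬IsFace nineConfig S := by
  obtain ⟨c, hc, hS⟩ := hS
  refine not_isFace_galeDual ((c.2.1 : ℝ) • LinearMap.fst ℝ ℝ (ℝ × ℝ) +
    (c.2.2.1 : ℝ) • (LinearMap.fst ℝ ℝ ℝ ∘ₗ LinearMap.snd ℝ ℝ (ℝ × ℝ)) +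
    (c.2.2.2 : ℝ) • (LinearMap.snd ℝ ℝ ℝ ∘ₗ LinearMap.snd ℝ ℝ (ℝ × ℝ))) fun i hi => ?_
  have := (nineNonfaces_spec c hc).2 i fun h => hi (hS (List.mem_toFinset.2 h))
  simpa using (Int.cast_pos (R := ℝ)).2 this

/-- Minimal nonfaces have 3 elements in the whole complex, nonfaces in the link of {7, 8} contain
one with 2 elements, and {0, 1, 7, 8} is a face; these match the orders 2, 1, 0 along the flag. -/
theorem goodFlag_nineConfig : GoodFlag nineConfig ∅ 2 [(7, 8), (0, 1)] := by
  refine .single (by decide) (by simp) (by simp) ?_ ?_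
    (.base (by decide) (by decide) (by decide) ?_ ?_ ?_)
  · intro G hG
    rw [Finset.empty_union]
    rcases nine_face_or_nonface G with h | ⟨c, hc, hcG⟩
    · exact isFace_nineConfig h
    · have := Finset.card_le_card hcG
      have := (nineNonfaces_spec c hc).1
      omega
  · intro G hG
    rw [Finset.empty_union] at hG
    rcases nine_face_or_nonface G with h | ⟨c, hc, hcG⟩
    · exact absurd (isFace_nineConfig h) hG
    · exact ⟨c.1.toFinset, hcG, (nineNonfaces_spec c hc).1.le,
        not_isFace_nineConfig ⟨c, hc, Finset.subset_union_right⟩⟩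
  · intro G hG
    rcases nine_link_face_or_nonface G with h | ⟨M, hMG, hM, -⟩
    · exact isFace_nineConfig h
    · have := Finset.card_le_card hMG
      omega
  · intro G hG
    rcases nine_link_face_or_nonface G with h | ⟨M, hMG, hM, hc⟩
    · exact absurd (isFace_nineConfig h) hG
    · exact ⟨M, hMG, hM.le, not_isFace_nineConfig hc⟩
  · intro G hG
    rw [Finset.card_eq_zero.1 (Nat.le_zero.1 hG)]
    exact isFace_nineConfig (by decide +kernel)

end VectorConfig

/-! ### The starting configuration for odd k -/

namespace VectorConfig

section TwoRow

variable (t : ℕ)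

/-- The position of a point: the points are listed group by group, two to each group. -/
def position (x : Fin (2 * t + 3) × Bool) : ℕ := 2 * x.1 + x.2.toNat

/-- Vectors in the plane of alternating signs: the two vectors of group `g` have sign `(-1) ^ g`. -/
def alternatingVectors (x : Fin (2 * t + 3) × Bool) : ℝ × ℝ :=
  ((-1) ^ (x.1 : ℕ), (-1) ^ (x.1 : ℕ) * position t x)

/-- The Gale dual of `alternatingVectors`. -/
noncomputable def alternatingConfig :
    Fin (2 * t + 3) × Bool → dependences (alternatingVectors t) →ₗ[ℝ] ℝ :=
  galeDual _

variable {t}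

theorem position_injective : Function.Injective (position t) := by
  rintro ⟨g, e⟩ ⟨g', e'⟩ h
  simp only [position] at h
  have h1 := Bool.toNat_le e
  have h2 := Bool.toNat_le e'
  have hg : g = g' := Fin.ext (by omega)
  subst hg
  cases e <;> cases e' <;> simp_all

theorem position_lt {x y : Fin (2 * t + 3) × Bool} (h : x.1 < y.1) : position t x < position t y := by
  have h1 := Bool.toNat_le x.2
  simp only [position]
  have : (x.1 : ℕ) < y.1 := h
  omega

theorem genPos_alternatingConfig : GenPos (alternatingConfig t) (4 * t + 3) := by
  refine genPos_galeDual (by simp; omega) ?_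
  intro S hS h h0 hsum
  obtain ⟨x, y, hxy, rfl⟩ := Finset.card_eq_two.1 (hS.trans (by simp : _ = 2))
  rw [← Finset.sum_subset (Finset.subset_univ {x, y})
    (fun i _ hi => by rw [h0 i hi, zero_smul]), Finset.sum_pair hxy] at hsum
  simp only [alternatingVectors, Prod.smul_mk, Prod.mk_add_mk, Prod.mk_eq_zero, smul_eq_mul] at hsum
  obtain ⟨e1, e2⟩ := hsum
  have hne : (position t x : ℝ) - position t y ≠ 0 :=
    sub_ne_zero.2 fun e => hxy (position_injective (Nat.cast_injective e))
  have hs : ∀ g : ℕ, ((-1 : ℝ) ^ g) ≠ 0 := fun g => pow_ne_zero _ (by norm_num)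
  have hx : h x = 0 := by
    refine (mul_eq_zero.1 ?_).resolve_right (mul_ne_zero (hs x.1) hne)
    linear_combination e2 - position t y * e1
  have hy : h y = 0 := by
    refine (mul_eq_zero.1 ?_).resolve_right (mul_ne_zero (hs y.1) hne)
    linear_combination position t x * e1 - e2
  funext i
  by_cases hi : i ∈ ({x, y} : Finset _)
  · simp only [Finset.mem_insert, Finset.mem_singleton] at hi
    rcases hi with rfl | rfl <;> assumption
  · exact h0 i hi

/-- Three points of the line with alternating signs are positively dependent: the gap between two
positions, taken as the weight of the third, gives the relation. -/
theorem isFace_alternatingConfig {S : Finset (Fin (2 * t + 3) × Bool)}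
    {x y z : Fin (2 * t + 3) × Bool} (hx : x ∉ S) (hy : y ∉ S) (hz : z ∉ S)
    (hxy : x.1 < y.1) (hyz : y.1 < z.1) (hxy' : Odd ((x.1 : ℕ) + y.1))
    (hyz' : Odd ((y.1 : ℕ) + z.1)) : IsFace (alternatingConfig t) S := by
  have h1 : (position t x : ℝ) < position t y := Nat.cast_lt.2 (position_lt hxy)
  have h2 : (position t y : ℝ) < position t z := Nat.cast_lt.2 (position_lt hyz)
  have nxy : x ≠ y := fun e => hxy.ne (congrArg Prod.fst e)
  have nyz : y ≠ z := fun e => hyz.ne (congrArg Prod.fst e)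
  have nxz : x ≠ z := fun e => (hxy.trans hyz).ne (congrArg Prod.fst e)
  refine isFace_galeDual
    (h := Pi.single x (position t z - position t y : ℝ) +
      Pi.single y (position t z - position t x : ℝ) +
      Pi.single z (position t y - position t x : ℝ)) ?_ ?_ ?_ ?_
  · intro e
    have := congrFun e x
    simp [nxy, nxz] at this
    linarith
  · intro i
    have nn : ∀ (j : Fin (2 * t + 3) × Bool) (r : ℝ), 0 ≤ r →
        0 ≤ (Pi.single j r : Fin (2 * t + 3) × Bool → ℝ) i := fun j r hr =>
      (Pi.single_nonneg (i := j).2 hr : (0 : Fin (2 * t + 3) × Bool → ℝ) ≤ Pi.single j r) i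
    exact add_nonneg (add_nonneg (nn _ _ (by linarith)) (nn _ _ (by linarith)))
      (nn _ _ (by linarith))
  · have hs : ∀ (j : Fin (2 * t + 3) × Bool) (r : ℝ),
        ∑ i, (Pi.single j r : Fin (2 * t + 3) × Bool → ℝ) i • alternatingVectors t i =
          r • alternatingVectors t j := by
      intro j r
      rw [Finset.sum_eq_single j (fun b _ hb => by rw [Pi.single_eq_of_ne hb, zero_smul])
        (fun h => absurd (Finset.mem_univ j) h), Pi.single_eq_same]
    have sgn : ∀ {a b : ℕ}, Odd (a + b) → (-1 : ℝ) ^ a = -(-1) ^ b := by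
      intro a b h
      have h1 : (-1 : ℝ) ^ a * (-1) ^ b = -1 := by rw [← pow_add, h.neg_one_pow]
      have h2 : (-1 : ℝ) ^ b * (-1) ^ b = 1 := by rw [← pow_add, (Even.add_self b).neg_one_pow]
      linear_combination (-1 : ℝ) ^ b * h1 - (-1 : ℝ) ^ a * h2
    simp only [Pi.add_apply, add_smul, Finset.sum_add_distrib, hs]
    have e1 := sgn hxy'
    have e2 := sgn hyz'
    refine Prod.ext ?_ ?_ <;>
      simp only [alternatingVectors, Prod.fst_add, Prod.snd_add, Prod.smul_fst, Prod.smul_snd,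
        smul_eq_mul, Prod.fst_zero, Prod.snd_zero, e1, e2] <;> ring
  · intro i hi
    have ne : ∀ {j}, j ∉ S → i ≠ j := fun hj e => hj (e ▸ hi)
    simp [ne hx, ne hy, ne hz]

/-- If the signs outside S change at most once, an affine function changing sign at the same place
certifies the nonface. The root 2T - 1/2 lies strictly between the positions of group T - 1 and
those of group T. -/
theorem not_isFace_alternatingConfig {S : Finset (Fin (2 * t + 3) × Bool)} (T ε : ℕ)
    (h : ∀ x, x ∉ S → ((x.1 : ℕ) % 2 = ε % 2 ↔ (x.1 : ℕ) < T)) :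
    ¬IsFace (alternatingConfig t) S := by
  refine not_isFace_galeDual (((-1) ^ ε * (2 * T - 1 / 2) : ℝ) • LinearMap.fst ℝ ℝ ℝ -
    ((-1) ^ ε : ℝ) • LinearMap.snd ℝ ℝ ℝ) fun x hx => ?_
  have hx := h x hx
  have hval : (((-1) ^ ε * (2 * T - 1 / 2) : ℝ) • LinearMap.fst ℝ ℝ ℝ -
      ((-1) ^ ε : ℝ) • LinearMap.snd ℝ ℝ ℝ) (alternatingVectors t x) =
      (-1) ^ (ε + x.1) * (2 * T - 1 / 2 - position t x) := by
    simp [alternatingVectors, pow_add]; ring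
  rw [hval]
  have hb := Bool.toNat_le x.2
  by_cases hT : (x.1 : ℕ) < T
  · have he : Even (ε + x.1) := by rw [Nat.even_iff]; have := hx.2 hT; omega
    have : position t x + 1 ≤ 2 * T := by simp only [position]; omega
    have : (position t x : ℝ) + 1 ≤ 2 * T := by exact_mod_cast this
    rw [he.neg_one_pow]
    linarith
  · have ho : Odd (ε + x.1) := by
      rw [Nat.odd_iff]; have := fun h => hT (hx.1 h); omega
    have : 2 * T ≤ position t x := by simp only [position]; omega
    have : (2 * T : ℝ) ≤ position t x := by exact_mod_cast this
    rw [ho.neg_one_pow]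
    linarith

/-- Let x be in the first group outside S and y in the first such group of the other parity. A later
z of the parity of x would give an alternating triple and hence a face, so T is the group of y. -/
theorem exists_threshold {S : Finset (Fin (2 * t + 3) × Bool)}
    (hS : ¬IsFace (alternatingConfig t) S) :
    ∃ T ε : ℕ, ∀ x, x ∉ S → ((x.1 : ℕ) % 2 = ε % 2 ↔ (x.1 : ℕ) < T) := by
  classical
  rcases (Sᶜ).eq_empty_or_nonempty with h | h
  · exact ⟨0, 0, fun x hx => absurd (Finset.mem_compl.2 hx) (h ▸ Finset.notMem_empty x)⟩
  obtain ⟨x, hx, hmin⟩ := Finset.exists_min_image Sᶜ Prod.fst h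
  rcases (Sᶜ.filter fun y => (y.1 : ℕ) % 2 ≠ (x.1 : ℕ) % 2).eq_empty_or_nonempty with h | h
  · refine ⟨2 * t + 3, x.1, fun z hz => ⟨fun _ => z.1.2, fun _ => ?_⟩⟩
    by_contra h'
    exact Finset.notMem_empty z (h ▸ Finset.mem_filter.2 ⟨Finset.mem_compl.2 hz, h'⟩)
  obtain ⟨y, hy, hymin⟩ := Finset.exists_min_image _ Prod.fst h
  rw [Finset.mem_filter] at hy
  refine ⟨y.1, x.1, fun z hz => ⟨fun h' => ?_, fun h' => ?_⟩⟩
  · by_contra hlt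
    have hxy : (x.1 : ℕ) ≤ y.1 := hmin y hy.1
    have := hy.2
    exact hS (isFace_alternatingConfig (Finset.mem_compl.1 hx) (Finset.mem_compl.1 hy.1) hz
      (show (x.1 : ℕ) < y.1 by omega) (show (y.1 : ℕ) < z.1 by omega)
      (by rw [Nat.odd_iff]; omega) (by rw [Nat.odd_iff]; omega))
  · by_contra hne
    have : (y.1 : ℕ) ≤ z.1 := hymin z (Finset.mem_filter.2 ⟨Finset.mem_compl.2 hz, hne⟩)
    omega

/-- The points in the groups after the first `2 * s + 3`. -/
def lateGroups (t s : ℕ) : Finset (Fin (2 * t + 3) × Bool) :=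
  Finset.univ.filter fun x => 2 * s + 3 ≤ (x.1 : ℕ)

theorem mem_lateGroups {s : ℕ} {x : Fin (2 * t + 3) × Bool} :
    x ∈ lateGroups t s ↔ 2 * s + 3 ≤ (x.1 : ℕ) := by
  simp [lateGroups]

/-- A selection of one group in each of several pairs of neighboring groups. -/
theorem exists_nonface_of_selection {s : ℕ} (hs : s ≤ t) {G : Finset (Fin (2 * t + 3) × Bool)}
    (c : ℕ → ℕ) (hc : Function.Injective c) (hle : ∀ i, c i ≤ 2 * i + 2)
    (hcG : ∀ x : Fin (2 * t + 3) × Bool, ∀ i ≤ s, (x.1 : ℕ) = c i → x ∈ G)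
    (hface : ∀ S : Finset (Fin (2 * t + 3) × Bool), lateGroups t s ⊆ S →
      (∀ x : Fin (2 * t + 3) × Bool, ∀ i ≤ s, (x.1 : ℕ) = c i → x ∈ S) →
        ¬IsFace (alternatingConfig t) S) :
    ∃ I ⊆ G, I.card = 2 * s + 2 ∧ ¬IsFace (alternatingConfig t) (lateGroups t s ∪ I) ∧
      (∀ x ∈ I, ∀ y : Fin (2 * t + 3) × Bool, y.1 = x.1 → y ∈ I) ∧
      ∀ x ∈ I, ∀ y ∈ I, 2 * s + 1 ≤ (x.1 : ℕ) → 2 * s + 1 ≤ (y.1 : ℕ) → x.1 = y.1 := by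
  classical
  let c' : Fin (s + 1) → Fin (2 * t + 3) := fun i => ⟨c i, by have := hle i; omega⟩
  have hc' : Function.Injective c' := fun i j h => Fin.ext (hc (congrArg Fin.val h))
  have hmem : ∀ x : Fin (2 * t + 3) × Bool,
      x ∈ Finset.univ.image c' ×ˢ (Finset.univ : Finset Bool) ↔ ∃ i ≤ s, (x.1 : ℕ) = c i := by
    intro x
    simp only [Finset.mem_product, Finset.mem_image, Finset.mem_univ, true_and, and_true]
    constructor
    · rintro ⟨i, hi⟩
      exact ⟨i, by omega, by rw [← hi]⟩
    · rintro ⟨i, hi, hx⟩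
      exact ⟨⟨i, by omega⟩, Fin.ext hx.symm⟩
  refine ⟨Finset.univ.image c' ×ˢ Finset.univ, ?_, ?_, ?_, ?_, ?_⟩
  · intro x hx
    obtain ⟨i, hi, hx⟩ := (hmem x).1 hx
    exact hcG x i hi hx
  · rw [Finset.card_product, Finset.card_image_of_injective _ hc']
    simp; omega
  · exact hface _ Finset.subset_union_left fun x i hi hx =>
      Finset.mem_union_right _ ((hmem x).2 ⟨i, hi, hx⟩)
  · intro x hx y hy
    rw [hmem] at hx ⊢
    rwa [hy]
  · intro x hx y hy h1 h2
    obtain ⟨i, hi, hxi⟩ := (hmem x).1 hx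
    obtain ⟨j, hj, hyj⟩ := (hmem y).1 hy
    have := hle i
    have := hle j
    -- Since c i ≤ 2 * i + 2, only the last choice i = s can reach group 2 * s + 1.
    have : i = j := by omega
    exact Fin.ext (by rw [hxi, hyj, this])

/-- A nonface contains every early group on the wrong side of the threshold. Pairing neighboring
groups, one group of each of s + 1 pairs is such, and these full groups already leave a single sign
change. Being a union of full groups, with at most one group numbered 2 * s + 1 or more, is what the
flag later exploits. -/
theorem exists_small_nonface {s : ℕ} (hs : s ≤ t) {G : Finset (Fin (2 * t + 3) × Bool)}
    (hG : ¬IsFace (alternatingConfig t) (lateGroups t s ∪ G)) :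
    ∃ I ⊆ G, I.card = 2 * s + 2 ∧ ¬IsFace (alternatingConfig t) (lateGroups t s ∪ I) ∧
      (∀ x ∈ I, ∀ y : Fin (2 * t + 3) × Bool, y.1 = x.1 → y ∈ I) ∧
      ∀ x ∈ I, ∀ y ∈ I, 2 * s + 1 ≤ (x.1 : ℕ) → 2 * s + 1 ≤ (y.1 : ℕ) → x.1 = y.1 := by
  obtain ⟨T, ε, hT⟩ := exists_threshold hG
  have hT' : ∀ x : Fin (2 * t + 3) × Bool, (x.1 : ℕ) < 2 * s + 3 →
      ¬((x.1 : ℕ) % 2 = ε % 2 ↔ (x.1 : ℕ) < T) → x ∈ G := by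
    intro x hx h
    by_contra hxG
    refine h (hT x fun hx' => ?_)
    rcases Finset.mem_union.1 hx' with hx' | hx'
    · have := mem_lateGroups.1 hx'
      omega
    · exact hxG hx'
  rcases Nat.mod_two_eq_zero_or_one ε with hε | hε
  -- For even sign class the pairs are {2i + 1, 2i + 2} and group 0 is left over.
  · refine exists_nonface_of_selection hs (fun i => if i < T / 2 then 2 * i + 1 else 2 * i + 2)
      ?_ ?_ ?_ ?_
    · intro i j h
      dsimp only at h
      split_ifs at h <;> omega
    · intro i
      split_ifs <;> omega
    · intro x i hi hx
      refine hT' x ?_ ?_ <;> split_ifs at hx <;> omega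
    · intro S hS hc
      refine not_isFace_alternatingConfig (2 * (T / 2) + 1) 0 fun x hx => ?_
      have h1 : ¬2 * s + 3 ≤ (x.1 : ℕ) := fun h => hx (hS (mem_lateGroups.2 h))
      have h2 : ∀ i, ¬(i ≤ s ∧ (x.1 : ℕ) = if i < T / 2 then 2 * i + 1 else 2 * i + 2) :=
        fun i h => hx (hc x i h.1 h.2)
      have h3 := h2 ((x.1 : ℕ) / 2)
      have h4 := h2 ((x.1 : ℕ) / 2 - 1)
      split_ifs at h3 h4 <;> omega
  · refine exists_nonface_of_selection hs
      (fun i => if i < (T + 1) / 2 then 2 * i else 2 * i + 1) ?_ ?_ ?_ ?_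
    · intro i j h
      dsimp only at h
      split_ifs at h <;> omega
    · intro i
      split_ifs <;> omega
    · intro x i hi hx
      refine hT' x ?_ ?_ <;> split_ifs at hx <;> omega
    · intro S hS hc
      -- Here the pairs are {2i, 2i + 1} and the leftover group 2s + 2 is even; it must lie above
      -- the threshold, hence the cap at s + 1.
      refine not_isFace_alternatingConfig (2 * min ((T + 1) / 2) (s + 1)) 1 fun x hx => ?_
      have h1 : ¬2 * s + 3 ≤ (x.1 : ℕ) := fun h => hx (hS (mem_lateGroups.2 h))
      have h2 : ∀ i, ¬(i ≤ s ∧ (x.1 : ℕ) = if i < (T + 1) / 2 then 2 * i else 2 * i + 1) :=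
        fun i h => hx (hc x i h.1 h.2)
      have h3 := h2 ((x.1 : ℕ) / 2)
      split_ifs at h3 <;> omega

theorem linkNeighborly_lateGroups {s : ℕ} (hs : s ≤ t) :
    LinkNeighborly (alternatingConfig t) (lateGroups t s) (2 * s + 1) := by
  intro G hG
  by_contra h
  obtain ⟨I, hI, hcard, -⟩ := exists_small_nonface hs h
  have := Finset.card_le_card hI
  omega

theorem linkMissing_lateGroups {s : ℕ} (hs : s ≤ t) :
    LinkMissing (alternatingConfig t) (lateGroups t s) (2 * s + 1) := by
  intro G hG
  obtain ⟨I, hI, hcard, h, -⟩ := exists_small_nonface hs hG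
  exact ⟨I, hI, hcard.le, h⟩

/-- The groups of a and b compete in the selection, so a small nonface contains at most one of the
two points and must still take 2 * s + 1 points from G. -/
theorem linkNeighborly_insert_lateGroups {s : ℕ} {a b : Fin (2 * t + 3) × Bool}
    (hs : s ≤ t) (ha : (a.1 : ℕ) = 2 * s + 2) (hb : (b.1 : ℕ) = 2 * s + 1) :
    LinkNeighborly (alternatingConfig t) (insert a (insert b (lateGroups t s))) (2 * s) := by
  intro G hG
  by_contra h
  rw [show insert a (insert b (lateGroups t s)) ∪ G = lateGroups t s ∪ insert a (insert b G) by
    simp [Finset.insert_union, Finset.union_insert]] at h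
  obtain ⟨I, hI, hcard, -, -, hI'⟩ := exists_small_nonface hs h
  have key : ∃ z, I ⊆ insert z G := by
    by_cases haI : a ∈ I
    · refine ⟨a, fun x hx => ?_⟩
      rcases Finset.mem_insert.1 (hI hx) with rfl | hx'
      · exact Finset.mem_insert_self _ _
      rcases Finset.mem_insert.1 hx' with rfl | hx'
      · have := congrArg Fin.val (hI' a haI x hx (by omega) (by omega))
        omega
      · exact Finset.mem_insert_of_mem hx'
    · exact ⟨b, (Finset.subset_insert_iff_of_notMem haI).1 hI⟩
  obtain ⟨z, hz⟩ := key
  have := Finset.card_le_card hz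
  have := Finset.card_insert_le z G
  omega

/-- The point c is the twin of a. A small nonface through c consists of full groups, so it contains
a as well and not b; dropping both a and c leaves 2 * s + 2 points. Nonfaces avoiding the group of a
need not shrink, which is why only those through c are bounded. -/
theorem linkMissingAt_lateGroups {s : ℕ} {a b c : Fin (2 * t + 3) × Bool} (hs : s + 1 ≤ t)
    (ha : (a.1 : ℕ) = 2 * s + 4) (hb : (b.1 : ℕ) = 2 * s + 3) (hac : a ≠ c)
    (hc : c.1 = a.1) :
    LinkMissingAt (alternatingConfig t) (insert a (insert b (lateGroups t (s + 1)))) c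
      (2 * s + 1) := by
  intro G hG hG'
  rw [show insert c (insert a (insert b (lateGroups t (s + 1))) ∪ G) =
    lateGroups t (s + 1) ∪ insert c (insert a (insert b G)) by
      simp [Finset.insert_union, Finset.union_insert]] at hG'
  obtain ⟨I, hI, hcard, hface, hfull, hI'⟩ := exists_small_nonface hs hG'
  have hcI : c ∈ I := by
    by_contra hcI
    refine hface (hG.mono ?_)
    rw [show insert a (insert b (lateGroups t (s + 1))) ∪ G =
      lateGroups t (s + 1) ∪ insert a (insert b G) by
        simp [Finset.insert_union, Finset.union_insert]]
    exact Finset.union_subset_union_right ((Finset.subset_insert_iff_of_notMem hcI).1 hI)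
  have haI : a ∈ I := hfull c hcI a hc.symm
  have hbI : b ∉ I := by
    intro hbI
    have := congrArg Fin.val (hI' a haI b hbI (by omega) (by omega))
    omega
  refine ⟨(I.erase c).erase a, ?_, ?_, fun h => hface (h.mono ?_)⟩
  · intro x hx
    rw [Finset.mem_erase, Finset.mem_erase] at hx
    have := hI hx.2.2
    simp only [Finset.mem_insert] at this
    rcases this with rfl | rfl | rfl | h
    exacts [absurd rfl hx.2.1, absurd rfl hx.1, absurd hx.2.2 hbI, h]
  · rw [Finset.card_erase_of_mem (Finset.mem_erase.2 ⟨hac, haI⟩), Finset.card_erase_of_mem hcI]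
    omega
  · intro x hx
    simp only [Finset.mem_insert, Finset.mem_union, Finset.mem_erase] at hx ⊢
    tauto

/-- One double step takes one point from each of two neighboring groups and then their twins,
thereby moving both groups into the late part and lowering s by one. -/
theorem exists_goodFlag_lateGroups {s : ℕ} (hs : s ≤ t) :
    ∃ L, GoodFlag (alternatingConfig t) (lateGroups t s) (2 * s + 1) L := by
  induction s with
  | zero =>
    refine ⟨_, .base (a := (⟨2, by omega⟩, false)) (b := (⟨1, by omega⟩, false)) (by simp)
      (by simp [mem_lateGroups]) (by simp [mem_lateGroups]) (linkNeighborly_lateGroups hs)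
      (linkMissing_lateGroups hs) (linkNeighborly_insert_lateGroups hs rfl rfl)⟩
  | succ s ih =>
    obtain ⟨L, hL⟩ := ih (by omega)
    obtain ⟨g, hg⟩ : ∃ g : Fin (2 * t + 3), (g : ℕ) = 2 * s + 4 := ⟨⟨_, by omega⟩, rfl⟩
    obtain ⟨g', hg'⟩ : ∃ g : Fin (2 * t + 3), (g : ℕ) = 2 * s + 3 := ⟨⟨_, by omega⟩, rfl⟩
    have hne : g ≠ g' := fun e => by rw [e] at hg; omega
    have hgF : ∀ e, (g, e) ∉ lateGroups t (s + 1) := fun e h => by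
      have : 2 * (s + 1) + 3 ≤ _ := mem_lateGroups.1 h
      dsimp only at this
      omega
    have hgF' : ∀ e, (g', e) ∉ lateGroups t (s + 1) := fun e h => by
      have : 2 * (s + 1) + 3 ≤ _ := mem_lateGroups.1 h
      dsimp only at this
      omega
    refine ⟨_, .double (k := 2 * s + 1) (a := (g, false)) (b := (g', false)) (c := (g, true))
      (d := (g', true)) (L := L) (by simp [hne]) (hgF _) (hgF' _) (by simp [hne])
      (by simp [hgF]) (by simp [hgF']) (linkNeighborly_lateGroups hs) (linkMissing_lateGroups hs)
      (linkNeighborly_insert_lateGroups hs hg hg')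
      (linkMissingAt_lateGroups hs hg hg' (by simp) rfl) ?_⟩
    convert hL using 1
    ext ⟨x, e⟩
    simp only [Finset.mem_insert, mem_lateGroups, Prod.mk.injEq, Fin.ext_iff, hg, hg']
    cases e <;> simp <;> omega

theorem exists_goodFlag_alternatingConfig :
    ∃ L, GoodFlag (alternatingConfig t) ∅ (2 * t + 1) L := by
  obtain ⟨L, hL⟩ := exists_goodFlag_lateGroups (le_refl t)
  refine ⟨L, ?_⟩
  rwa [show lateGroups t t = ∅ from Finset.filter_eq_empty_iff.2 fun x _ => by omega] at hL

end TwoRow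

end VectorConfig

/-! ### Extension of the two starting configurations to n vertices -/

open VectorConfig in
theorem mainTheorem4 (k n : ℕ)
    (h : (Odd k ∧ 3 ≤ k ∧ 2 * k + 4 ≤ n) ∨ (k = 2 ∧ 9 ≤ n)) :
    ∃ P : Set (EuclideanSpace ℝ (Fin (2 * k + 1))),
      ConvexPolytope.IsNeighborly P ∧
      ConvexPolytope.dim P = 2 * k + 1 ∧
      (ConvexPolytope.vertices P).ncard = n ∧
      (∀ M : Finset (EuclideanSpace ℝ (Fin (2 * k + 1))),
        ConvexPolytope.IsMissingFace P M → M.card = k + 1) ∧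
      ConvexPolytope.missingFaceCount P (k + 1) = 0 := by
  rcases h with ⟨⟨t, rfl⟩, -, hn⟩ | ⟨rfl, hn⟩
  · obtain ⟨L, hL⟩ := exists_goodFlag_alternatingConfig (t := t)
    obtain ⟨ι, _, _, v, L, rfl, hv, hG⟩ := exists_goodFlag_of_le hn
      ⟨_, inferInstance, inferInstance, alternatingConfig t, L, by simp; omega,
        genPos_alternatingConfig, hL⟩
    rw [show 4 * t + 3 = 2 * (2 * t + 1) + 1 by ring] at hv
    exact exists_polytope (by omega) hv hG.linkNeighborly hG.linkMissing
  · obtain ⟨ι, _, _, v, L, rfl, hv, hG⟩ := exists_goodFlag_of_le hn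
      ⟨_, inferInstance, inferInstance, nineConfig, _, by simp, genPos_nineConfig,
        goodFlag_nineConfig⟩
    exact exists_polytope (by omega) hv hG.linkNeighborly hG.linkMissing
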